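/- **Weights.** A *weight function* is a non-decreasing $\sigma:[0,\infty)\to[0,\infty)$ with $\lim_{t\to\infty}\sigma(t)=\infty$. Let $\mathcal W_0$ be the set of continuous weight functions $\omega$ with $\omega(t)=0$ for $t\in[0,1]$, $\log t=o(\omega(t))$ as $t\to\infty$, and $y\mapsto\omega(e^y)$ convex on $\mathbb R$. For a weight function $\sigma$ with $\log t=o(\sigma(t))$ put $$\varphi_\sigma^*(x)=\sup_{y\in\mathbb R}\{xy-\sigma(e^y)\}\ (x\ge 0),\qquad S^{(\ell)}_p=\exp\!\Big(\tfrac1\ell\varphi^*_\sigma(\ell p)\Big)\ (\ell>0,\ p\in\mathbb N),$$ and write $\mathcal M_\omega=\{\mathbf W^{(\ell)}:\ell>0\}$ for the matrix obtained in this way from $\omega\in\mathcal W_0$ (there the supremum may be restricted to $y\ge0$). Let $\mathbf G^\alpha=(p!^\alpha)_p$ and $\mathcal M_\omega/\mathbf G^\alpha=\{\mathbf W^{(\ell)}/\mathbf G^\alpha:\ell>0\}$ (pointwise quotients). For a positive sequence $\mathbf M$ with $M_0=1$ let $\omega_{\mathbf M}(t)=\sup_{p}\log(t^p/M_p)$.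 Let $$(\sigma\widehat\star\tau)(t)=\sup_{s\ge0}\{\sigma(s)-\tau(s/t)\}\ (t>0),\quad (\sigma\widehat\star\tau)(0)=\sigma(0)-\tau(0),\qquad \sigma^\star(t)=\sup_{s\ge0}\{\sigma(s)-ts\}\ (t>0),$$ $\sigma^\iota(t)=\sigma(1/t)$ for $t>0$, $\sigma^{a}(t)=\sigma(t^{a})$ and $\mathrm{id}^{a}(t)=t^{a}$ for $a>0$; the function $(((\omega^\alpha)^\star)^\iota)^{1/\alpha}$ below is given the value $0$ at $t=0$. **Growth index.** For a positive sequence $\mathbf M$ with quotients $\mu_p=M_p/M_{p-1}$ $(p\ge1)$, Thilliez's index $\gamma(\mathbf M)\in[0,\infty]$ is the supremum of all $\gamma>0$ for which there are $a\ge1$ and $(\nu_p)_{p\ge1}$ with $a^{-1}\mu_p\le\nu_p\le a\mu_p$ and $(\nu_p/p^\gamma)_{p\ge1}$ non-decreasing ($\gamma(\mathbf M)=0$ if there is none). **Spaces.** For a positive sequence $w$ consider the following norms: - $\|f\|_{O,w}=\sup_{x\in O,\,\beta\in\mathbb N^d}|\partial^\beta f(x)|/w_{|\beta|}$ for $f\in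 C^\infty(O)$, $O\subseteq\mathbb R^d$ open; - $\sup_{\zeta\in S,\,p\in\mathbb N}|f^{(p)}(\zeta)|/w_p$ for $f$ holomorphic on a sector $S=\{a<\arg\zeta<b\}$ of the Riemann surface of the logarithm; - $\sup_{x\in\mathbb R^d,\,k\in\mathbb N,\,\beta\in\mathbb N^d}(1+|x|)^k|\partial^\beta f(x)|/w_{k+|\beta|}$ for $f\in C^\infty(\mathbb R^d)$; - $\sup_p|a_p|/w_p$ for complex sequences $(a_p)_{p\in\mathbb N}$; - $\sup_\beta|F_\beta|/w_{|\beta|}$ for formal power series $F=\sum_{\beta\in\mathbb N^d}F_\beta x^\beta$ with complex coefficients. For a directed set $\mathcal V$ of positive sequences $w$, the elements for which the respective norm is finite for some $w\in\mathcal V$ (Roumieu type, with the locally convex inductive limit topology over $w\in\mathcal V$), respectively for all $w\in\mathcal V$ (Beurling type, with the projective limit topology), form the spaces $\mathcal B(O)$, $\mathcal A(S)$, $\mathcal S(\mathbb R^d)$, $\Lambda$, $\mathcal F$ of the respective type. The space $\mathcal E(U)$ of either type, $U\subseteq\mathbb R^d$ open, consists of those $f\in C^\infty(U)$ whose restriction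 to each open $O$ with $\overline O\subset U$ compact belongs to $\mathcal B(O)$, with the projective limit topology over all such $O$. For a matrix $\mathcal M=\{\mathbf M^{(\ell)}:\ell>0\}$, $\mathfrak F_{[\mathcal M]}$ denotes either type for $\mathcal V=\{(h^pM^{(\ell)}_p)_p:h,\ell>0\}$; for a weight function $\sigma$ with $\log t=o(\sigma(t))$, $\mathfrak F_{[\sigma]}$ denotes either type for $\mathcal V=\{\mathbf S^{(\ell)}:\ell>0\}$. Here $\mathfrak F\in\{\mathcal E,\mathcal B,\mathcal A,\mathcal S,\Lambda,\mathcal F\}$ on any of the domains above. **Theorem.** Let $\omega\in\mathcal W_0$ and $\alpha>0$. Assume that (i) there is $\ell_0>0$ with $\gamma(\mathbf W^{(\ell_0)})>\alpha$, and (ii) $\omega(t)=o(t^{1/\alpha})$ as $t\to\infty$. Then for all $c,\ell>0$ the functions $$\omega_{\mathbf W^{(c\ell_0)}/\mathbf G^\alpha},\quad \omega_{\mathbf W^{(\ell)}}\widehat\star\omega_{\mathbf G^\alpha},\quad \omega\widehat\star\omega_{\mathbf G^\alpha},\quad \omega\widehat\star\mathrm{id}^{1/\alpha},\quad (((\omega^\alpha)^\star)^\iota)^{1/\alpha}$$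 are well defined (all suprema involved in their definition are finite) and are weight functions $v$ with $\log t=o(v(t))$, and, both for the Roumieu and for the Beurling type, one has, as locally convex vector spaces, $$\mathfrak F_{[\mathcal M_\omega/\mathbf G^\alpha]}=\mathfrak F_{[\omega_{\mathbf W^{(c\ell_0)}/\mathbf G^\alpha}]}=\mathfrak F_{[\omega_{\mathbf W^{(\ell)}}\widehat\star\omega_{\mathbf G^\alpha}]}=\mathfrak F_{[\omega\widehat\star\omega_{\mathbf G^\alpha}]}=\mathfrak F_{[\omega\widehat\star\mathrm{id}^{1/\alpha}]}=\mathfrak F_{[(((\omega^\alpha)^\star)^\iota)^{1/\alpha}]}$$ for every $\mathfrak F\in\{\mathcal E,\mathcal B,\mathcal A,\mathcal S,\Lambda,\mathcal F\}$. -/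

import Mathlib

open Filter Topology Set Asymptotics
open scoped ENNReal

noncomputable section

namespace WeightedSpaces

/-! ### Weight functions

A function on `[0, +∞)` is represented by a function on `ℝ` of which only the values at
nonnegative arguments are ever used. -/

/-- Weight function: nonnegative, non-decreasing on `[0, +∞)`, tending to `+∞`. -/
structure IsWeightFunction (σ : ℝ → ℝ) : Prop where
  nonneg : ∀ t, 0 ≤ t → 0 ≤ σ t
  mono : MonotoneOn σ (Ici 0)
  tendsto : Tendsto σ atTop atTop

/-- The class `𝒲₀` of normalized weight functions in the sense of Braun, Meise and Taylor. -/
structure IsBMTWeight (ω : ℝ → ℝ) : Prop where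
  continuousOn : ContinuousOn ω (Ici 0)
  mono : MonotoneOn ω (Ici 0)
  normalized : ∀ t, 0 ≤ t → t ≤ 1 → ω t = 0
  tendsto : Tendsto ω atTop atTop
  log_isLittleO : Real.log =o[atTop] ω
  convex : ConvexOn ℝ univ (fun y : ℝ => ω (Real.exp y))

/-- The conjugate `φ*_σ(x) = sup_y (x y - φ_σ(y))` of `φ_σ(y) = σ(e^y)`. The supremum runs over
all real `y`, which is the definition for weights that need not be normalized; for normalized
weights it may be restricted to `y ≥ 0`, see `youngConj_eq_of_normalized`. -/
def youngConj (σ : ℝ → ℝ) (x : ℝ) : ℝ := sSup (range fun y : ℝ => x * y - σ (Real.exp y))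

theorem youngConj_eq_of_normalized {σ : ℝ → ℝ} (h : ∀ t, 0 ≤ t → t ≤ 1 → σ t = 0) {x : ℝ}
    (hx : 0 ≤ x) :
    youngConj σ x = sSup ((fun y : ℝ => x * y - σ (Real.exp y)) '' Ici 0) := by
  refine csSup_eq_csSup_of_forall_exists_le ?_ ?_
  · rintro _ ⟨y, rfl⟩
    rcases le_total 0 y with hy | hy
    · exact ⟨_, ⟨y, hy, rfl⟩, le_rfl⟩
    · refine ⟨_, ⟨0, by simp, rfl⟩, ?_⟩
      have h1 : σ (Real.exp y) = 0 := h _ (Real.exp_pos y).le (Real.exp_le_one_iff.2 hy)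
      have h2 : σ (Real.exp 0) = 0 := h _ (Real.exp_pos 0).le (by simp)
      simp only [h1, h2]
      nlinarith [mul_nonneg hx (neg_nonneg.2 hy)]
  · rintro _ ⟨y, _, rfl⟩
    exact ⟨_, ⟨y, rfl⟩, le_rfl⟩

/-- The associated weight matrix `W^(ℓ)_p = exp (φ*_σ(ℓ p) / ℓ)`, with index `ℓ > 0`. -/
def assocMatrix (σ : ℝ → ℝ) (ℓ : ℝ) (p : ℕ) : ℝ := Real.exp (1 / ℓ * youngConj σ (ℓ * p))

/-- The Gevrey sequence `p!^s`. -/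
def gevrey (s : ℝ) (p : ℕ) : ℝ := (p.factorial : ℝ) ^ s

/-- The matrix `ℳ_ω / G^α = {W^(ℓ) / G^α : ℓ > 0}`. -/
def quotientMatrix (ω : ℝ → ℝ) (α : ℝ) (ℓ : ℝ) (p : ℕ) : ℝ := assocMatrix ω ℓ p / gevrey α p

/-- The associated weight function `ω_M(t) = sup_p log (t^p / M_p)` of a sequence with `M_0 = 1`.
At `t = 0` the terms with `p ≥ 1` are `0` here instead of `-∞`; the term `p = 0` is `0`, so this
leaves the supremum `ω_M(0) = 0` unchanged. -/
def assocFun (M : ℕ → ℝ) (t : ℝ) : ℝ := sSup (range fun p : ℕ => Real.log (t ^ p / M p))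

/-- `ω_M` has finite values. -/
def AssocFunFinite (M : ℕ → ℝ) : Prop :=
  ∀ t : ℝ, 0 ≤ t → BddAbove (range fun p : ℕ => Real.log (t ^ p / M p))

/-- The generalized upper Legendre conjugate
`(σ ⋆̂ τ)(t) = sup_{s ≥ 0} (σ(s) - τ(s / t))` for `t > 0`, and `σ(0) - τ(0)` at `t = 0`. -/
def upperConj (σ τ : ℝ → ℝ) (t : ℝ) : ℝ :=
  if t = 0 then σ 0 - τ 0 else sSup ((fun s : ℝ => σ s - τ (s / t)) '' Ici 0)

/-- `σ ⋆̂ τ` has finite values. -/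
def UpperConjFinite (σ τ : ℝ → ℝ) : Prop :=
  ∀ t : ℝ, 0 < t → BddAbove ((fun s : ℝ => σ s - τ (s / t)) '' Ici 0)

/-- The upper Legendre conjugate `σ^⋆(t) = sup_{s ≥ 0} (σ(s) - t s)`. -/
def upperLegendre (σ : ℝ → ℝ) (t : ℝ) : ℝ := sSup ((fun s : ℝ => σ s - t * s) '' Ici 0)

/-- `σ^⋆` has finite values on `(0, +∞)`. -/
def UpperLegendreFinite (σ : ℝ → ℝ) : Prop :=
  ∀ t : ℝ, 0 < t → BddAbove ((fun s : ℝ => σ s - t * s) '' Ici 0)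

/-- The inversion `σ^ι(t) = σ(1 / t)` for `t > 0`. The value at `t = 0`, where `1 / t` makes no
sense, is set to `0`; it is never used in the definition of the weighted spaces. -/
def inversion (σ : ℝ → ℝ) (t : ℝ) : ℝ := if t = 0 then 0 else σ (1 / t)

/-- The power substitution `σ^a(t) = σ(t^a)`. -/
def powSubst (σ : ℝ → ℝ) (a : ℝ) (t : ℝ) : ℝ := σ (t ^ a)

/-- The function `id^a : t ↦ t^a`. -/
def idPow (a : ℝ) (t : ℝ) : ℝ := t ^ a

/-! ### The growth index of Thilliez -/

/-- The quotients `μ_p = M_p / M_{p-1}` for `p ≥ 1` and `μ_0 = 1`. -/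
def quot (M : ℕ → ℝ) : ℕ → ℝ
  | 0 => 1
  | p + 1 => M (p + 1) / M p

/-- The sequence of quotients of `M / G^γ` is equivalent to a non-decreasing one: there is
`(ν_p)` with `a⁻¹ μ_p ≤ ν_p ≤ a μ_p` such that `ν_p / p^γ` is non-decreasing in `p ≥ 1`. -/
def ThilliezProperty (M : ℕ → ℝ) (γ : ℝ) : Prop :=
  ∃ ν : ℕ → ℝ, ∃ a : ℝ, 1 ≤ a ∧
    (∀ p : ℕ, 1 ≤ p → a⁻¹ * quot M p ≤ ν p ∧ ν p ≤ a * quot M p) ∧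
    ∀ p : ℕ, 1 ≤ p → ν p / (p : ℝ) ^ γ ≤ ν (p + 1) / ((p + 1 : ℕ) : ℝ) ^ γ

/-- `γ(M) ∈ [0, +∞]`, the supremum of all `γ > 0` with the above property (`0` if there is
none). -/
def thilliezIndex (M : ℕ → ℝ) : ℝ≥0∞ :=
  ⨆ (γ : ℝ) (_ : 0 < γ ∧ ThilliezProperty M γ), ENNReal.ofReal γ

/-! ### Locally convex spaces inside an ambient vector space -/

/-- A locally convex vector space whose underlying vector space is a subspace of `V`. Equality of
two such objects means the same elements and the same topology. -/
structure LCSubspace (V : Type) [AddCommGroup V] [Module ℂ V] where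
  carrier : Submodule ℂ V
  topology : TopologicalSpace carrier
  isTopologicalAddGroup : @IsTopologicalAddGroup carrier topology _
  continuousSMul : @ContinuousSMul ℂ carrier _ _ topology
  locallyConvex : @LocallyConvexSpace ℝ carrier _ _ _ _ topology

/-- The subspace `W` with the locally convex topology generated by a set of seminorms. -/
def LCSubspace.ofSeminorms {V : Type} [AddCommGroup V] [Module ℂ V] (W : Submodule ℂ V)
    (P : Set (Seminorm ℂ W)) : LCSubspace V where
  carrier := W
  topology := (SeminormFamily.moduleFilterBasis (fun p : P => (p : Seminorm ℂ W))).topology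
  isTopologicalAddGroup :=
    letI := (SeminormFamily.moduleFilterBasis (fun p : P => (p : Seminorm ℂ W))).topology
    WithSeminorms.topologicalAddGroup (p := fun p : P => (p : Seminorm ℂ W)) ⟨rfl⟩
  continuousSMul :=
    letI := (SeminormFamily.moduleFilterBasis (fun p : P => (p : Seminorm ℂ W))).topology
    WithSeminorms.continuousSMul (p := fun p : P => (p : Seminorm ℂ W)) ⟨rfl⟩
  locallyConvex :=
    letI := (SeminormFamily.moduleFilterBasis (fun p : P => (p : Seminorm ℂ W))).topology
    WithSeminorms.toLocallyConvexSpace (p := fun p : P => (p : Seminorm ℂ W)) ⟨rfl⟩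

/-- The data from which weighted spaces are built: an ambient space `V` (all smooth functions, all
sequences, ...), local spaces `L i` with restriction maps `res i : V → L i`, and on `L i`, for each
order `n`, a family of linear functionals `ev i n a` (the derivatives of order `n` at the points
of a set, the entry number `n`, ...) to be controlled by the `n`-th entry of a weight sequence. -/
structure Setting where
  V : Type
  [groupV : AddCommGroup V]
  [moduleV : Module ℂ V]
  I : Type
  L : I → Type
  [groupL : ∀ i, AddCommGroup (L i)]
  [moduleL : ∀ i, Module ℂ (L i)]
  res : ∀ i, V →ₗ[ℂ] L i
  A : I → ℕ → Type
  ev : ∀ i n, A i n → (L i →ₗ[ℂ] ℂ)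

attribute [instance] Setting.groupV Setting.moduleV Setting.groupL Setting.moduleL

namespace Setting

variable (S : Setting) (i : S.I) (w : ℕ → ℝ)

/-- The space of all `f ∈ L i` with `sup_{n, a} |ev i n a f| / w_n < ∞`, for `w > 0`. -/
def step : Submodule ℂ (S.L i) where
  carrier := {f | ∃ C : ℝ, 0 ≤ C ∧ ∀ n a, ‖S.ev i n a f‖ ≤ C * w n}
  add_mem' := by
    rintro f g ⟨C, hC, hf⟩ ⟨D, hD, hg⟩
    refine ⟨C + D, add_nonneg hC hD, fun n a => ?_⟩
    rw [map_add, add_mul]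
    exact (norm_add_le _ _).trans (add_le_add (hf n a) (hg n a))
  zero_mem' := ⟨0, le_rfl, fun n a => by simp⟩
  smul_mem' := by
    rintro c f ⟨C, hC, hf⟩
    refine ⟨‖c‖ * C, mul_nonneg (norm_nonneg c) hC, fun n a => ?_⟩
    rw [map_smul, norm_smul, mul_assoc]
    exact mul_le_mul_of_nonneg_left (hf n a) (norm_nonneg c)

/-- The number `sup_{n, a} |ev i n a f| / w_n`. -/
def stepNorm (f : S.L i) : ℝ := ⨆ x : (Σ n, S.A i n), ‖S.ev i x.1 x.2 f‖ / w x.1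

theorem div_nonneg_of_mem {f : S.L i} (hf : f ∈ S.step i w) (x : Σ n, S.A i n) :
    0 ≤ ‖S.ev i x.1 x.2 f‖ / w x.1 := by
  obtain ⟨C, hC, h⟩ := hf
  rcases le_or_gt 0 (w x.1) with hw | hw
  · exact div_nonneg (norm_nonneg _) hw
  · have h0 : ‖S.ev i x.1 x.2 f‖ = 0 :=
      le_antisymm ((h x.1 x.2).trans (mul_nonpos_of_nonneg_of_nonpos hC hw.le)) (norm_nonneg _)
    simp [h0]

theorem bddAbove_of_mem {f : S.L i} (hf : f ∈ S.step i w) :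
    BddAbove (range fun x : (Σ n, S.A i n) => ‖S.ev i x.1 x.2 f‖ / w x.1) := by
  obtain ⟨C, hC, h⟩ := hf
  refine ⟨C, ?_⟩
  rintro _ ⟨x, rfl⟩
  rcases lt_or_ge 0 (w x.1) with hw | hw
  · exact (div_le_iff₀ hw).2 (h x.1 x.2)
  · exact (div_nonpos_of_nonneg_of_nonpos (norm_nonneg _) hw).trans hC

theorem stepNorm_add_le {f g : S.L i} (hf : f ∈ S.step i w) (hg : g ∈ S.step i w) :
    S.stepNorm i w (f + g) ≤ S.stepNorm i w f + S.stepNorm i w g := by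
  refine Real.iSup_le (fun x => ?_) (add_nonneg
    (Real.iSup_nonneg fun x => S.div_nonneg_of_mem i w hf x)
    (Real.iSup_nonneg fun x => S.div_nonneg_of_mem i w hg x))
  refine le_trans ?_ (add_le_add (le_ciSup (S.bddAbove_of_mem i w hf) x)
    (le_ciSup (S.bddAbove_of_mem i w hg) x))
  rcases le_or_gt 0 (w x.1) with hw | hw
  · simp only [map_add, ← add_div]
    exact div_le_div_of_nonneg_right (norm_add_le _ _) hw
  · exact (div_nonpos_of_nonneg_of_nonpos (norm_nonneg _) hw.le).trans
      (add_nonneg (S.div_nonneg_of_mem i w hf x) (S.div_nonneg_of_mem i w hg x))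

/-- `stepNorm` as a seminorm on `step`. -/
def stepSeminorm : Seminorm ℂ (S.step i w) :=
  Seminorm.of (fun f => S.stepNorm i w f.1) (fun f g => S.stepNorm_add_le i w f.2 g.2)
    (fun c f => by
      simp only [stepNorm, Submodule.coe_smul, map_smul, norm_smul, mul_div_assoc]
      rw [Real.mul_iSup_of_nonneg (norm_nonneg c)])

/-- The union of the spaces `step i w`, `w ∈ 𝒲` (the supremum of these subspaces, which is their
union because the scales of weights in use are directed). -/
def union (𝒲 : Set (ℕ → ℝ)) : Submodule ℂ (S.L i) := ⨆ w ∈ 𝒲, S.step i w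

/-- The seminorms on the union that are continuous on each step; they generate the locally convex
inductive limit topology. -/
def unionSeminorms (𝒲 : Set (ℕ → ℝ)) : Set (Seminorm ℂ (S.union i 𝒲)) :=
  {q | ∀ w ∈ 𝒲, ∃ C : ℝ, ∀ f : S.union i 𝒲, f.1 ∈ S.step i w → q f ≤ C * S.stepNorm i w f.1}

/-- The underlying vector space of Roumieu type. -/
def roumieuCarrier (𝒲 : Set (ℕ → ℝ)) : Submodule ℂ S.V := ⨅ i, (S.union i 𝒲).comap (S.res i)

/-- The restriction map from the Roumieu type space to the `i`-th union. -/
def roumieuRes (𝒲 : Set (ℕ → ℝ)) : S.roumieuCarrier 𝒲 →ₗ[ℂ] S.union i 𝒲 :=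
  ((S.res i).comp (S.roumieuCarrier 𝒲).subtype).codRestrict (S.union i 𝒲)
    (fun f => (Submodule.mem_iInf _).1 f.2 i)

/-- The space of Roumieu type for the scale `𝒲`: the projective limit over `i` of the locally
convex inductive limits over `w ∈ 𝒲` of the seminormed spaces `step i w`. -/
def roumieu (𝒲 : Set (ℕ → ℝ)) : LCSubspace S.V :=
  LCSubspace.ofSeminorms (S.roumieuCarrier 𝒲)
    {q | ∃ i, ∃ q' ∈ S.unionSeminorms i 𝒲, q = q'.comp (S.roumieuRes i 𝒲)}

/-- The underlying vector space of Beurling type. -/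
def beurlingCarrier (𝒲 : Set (ℕ → ℝ)) : Submodule ℂ S.V :=
  ⨅ i, ⨅ w : 𝒲, (S.step i w.1).comap (S.res i)

/-- The restriction map from the Beurling type space to `step i w`. -/
def beurlingRes (𝒲 : Set (ℕ → ℝ)) (w : 𝒲) : S.beurlingCarrier 𝒲 →ₗ[ℂ] S.step i w.1 :=
  ((S.res i).comp (S.beurlingCarrier 𝒲).subtype).codRestrict (S.step i w.1)
    (fun f => (Submodule.mem_iInf _).1 ((Submodule.mem_iInf _).1 f.2 i) w)

/-- The space of Beurling type for the scale `𝒲`: the projective limit over `i` and over `w ∈ 𝒲`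
of the seminormed spaces `step i w`. -/
def beurling (𝒲 : Set (ℕ → ℝ)) : LCSubspace S.V :=
  LCSubspace.ofSeminorms (S.beurlingCarrier 𝒲)
    {q | ∃ i, ∃ w : 𝒲, q = (S.stepSeminorm i w.1).comp (S.beurlingRes i 𝒲 w)}

end Setting

/-! ### Scales of weight sequences -/

/-- The sequences `(h^p M^(ℓ)_p)_p`, `h, ℓ > 0`, of a weight matrix `ℳ = {M^(ℓ) : ℓ > 0}`. -/
def matrixScale (M : ℝ → ℕ → ℝ) : Set (ℕ → ℝ) :=
  {w | ∃ h ℓ : ℝ, 0 < h ∧ 0 < ℓ ∧ w = fun p => h ^ p * M ℓ p}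

/-- The sequences `(exp (φ*_σ(ℓ p) / ℓ))_p`, `ℓ > 0`, of a weight function `σ`. -/
def functionScale (σ : ℝ → ℝ) : Set (ℕ → ℝ) := {w | ∃ ℓ : ℝ, 0 < ℓ ∧ w = assocMatrix σ ℓ}

/-! ### The ambient spaces -/

/-- The space `C^∞(U)` of smooth complex valued functions on an open subset `U` of `ℝ^d`. A
function on `U` is represented by its extension by `0`. -/
def smoothFun {d : ℕ} (U : TopologicalSpace.Opens (EuclideanSpace ℝ (Fin d))) :
    Submodule ℂ (EuclideanSpace ℝ (Fin d) → ℂ) where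
  carrier := {f | ContDiffOn ℝ (⊤ : ℕ∞) f U ∧ ∀ x ∉ U, f x = 0}
  add_mem' := by
    rintro f g ⟨hf, hf'⟩ ⟨hg, hg'⟩
    exact ⟨hf.add hg, fun x hx => by simp [hf' x hx, hg' x hx]⟩
  zero_mem' := ⟨contDiffOn_const, fun _ _ => rfl⟩
  smul_mem' := by
    rintro c f ⟨hf, hf'⟩
    exact ⟨contDiffOn_const.smul hf, fun x hx => by simp [hf' x hx]⟩

/-- The restriction `C^∞(U) → C^∞(O)` for `O ⊆ U`. -/
def smoothRes {d : ℕ} {U O : TopologicalSpace.Opens (EuclideanSpace ℝ (Fin d))} (h : O ≤ U) :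
    smoothFun U →ₗ[ℂ] smoothFun O where
  toFun f := ⟨(O : Set (EuclideanSpace ℝ (Fin d))).indicator f.1,
    (f.2.1.mono h).congr fun _ hx => indicator_of_mem hx _,
    fun _ hx => indicator_of_notMem hx _⟩
  map_add' _ _ := Subtype.ext (indicator_add _ _ _)
  map_smul' c _ := Subtype.ext (indicator_const_smul _ c _)

/-- The partial derivative `∂_{v_1} ⋯ ∂_{v_n} f(x)` of `f ∈ C^∞(U)` at a point `x ∈ U`. -/
def partialDeriv {d : ℕ} {U : TopologicalSpace.Opens (EuclideanSpace ℝ (Fin d))} (x : U)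
    {n : ℕ} (v : Fin n → Fin d) : smoothFun U →ₗ[ℂ] ℂ where
  toFun f := iteratedFDeriv ℝ n f.1 x.1 (fun k => EuclideanSpace.single (v k) (1 : ℝ))
  map_add' f g := by
    have hf : ContDiffAt ℝ n f.1 x.1 :=
      (f.2.1.contDiffAt (U.isOpen.mem_nhds x.2)).of_le (by exact_mod_cast le_top)
    have hg : ContDiffAt ℝ n g.1 x.1 :=
      (g.2.1.contDiffAt (U.isOpen.mem_nhds x.2)).of_le (by exact_mod_cast le_top)
    rw [Submodule.coe_add, iteratedFDeriv_add_apply hf hg]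
    rfl
  map_smul' c f := by
    have hf : ContDiffAt ℝ n f.1 x.1 :=
      (f.2.1.contDiffAt (U.isOpen.mem_nhds x.2)).of_le (by exact_mod_cast le_top)
    rw [Submodule.coe_smul, iteratedFDeriv_const_smul_apply hf]
    rfl

/-- The logarithmic image `{z : a < Im z < b}` of the sector `{ζ : a < arg ζ < b}` of the Riemann
surface of the logarithm. -/
def logSector (a b : ℝ) : Set ℂ := {z | a < z.im ∧ z.im < b}

theorem isOpen_logSector (a b : ℝ) : IsOpen (logSector a b) :=
  (isOpen_lt continuous_const Complex.continuous_im).inter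
    (isOpen_lt Complex.continuous_im continuous_const)

/-- The holomorphic functions on the sector `{ζ : a < arg ζ < b}` of the Riemann surface of the
logarithm, written in the global coordinate `z = log ζ` and extended by `0`. -/
def holoFun (a b : ℝ) : Submodule ℂ (ℂ → ℂ) where
  carrier := {f | DifferentiableOn ℂ f (logSector a b) ∧ ∀ z ∉ logSector a b, f z = 0}
  add_mem' := by
    rintro f g ⟨hf, hf'⟩ ⟨hg, hg'⟩
    exact ⟨hf.add hg, fun x hx => by simp [hf' x hx, hg' x hx]⟩
  zero_mem' := ⟨differentiableOn_const _, fun _ _ => rfl⟩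
  smul_mem' := by
    rintro c f ⟨hf, hf'⟩
    exact ⟨hf.const_smul c, fun x hx => by simp [hf' x hx]⟩

/-- The complex derivative `f ↦ df/dζ` on the sector. In the coordinate `z = log ζ` it is
`e^{-z} d/dz`. -/
def sectorDeriv (a b : ℝ) : holoFun a b →ₗ[ℂ] holoFun a b where
  toFun f := ⟨(logSector a b).indicator fun z => Complex.exp (-z) * deriv f.1 z,
    (((differentiable_neg.cexp).differentiableOn).mul
      (f.2.1.deriv (isOpen_logSector a b))).congr fun _ hx => indicator_of_mem hx _,
    fun _ hx => indicator_of_notMem hx _⟩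
  map_add' f g := by
    refine Subtype.ext (funext fun z => ?_)
    by_cases hz : z ∈ logSector a b
    · have hf := f.2.1.differentiableAt ((isOpen_logSector a b).mem_nhds hz)
      have hg := g.2.1.differentiableAt ((isOpen_logSector a b).mem_nhds hz)
      simp only [Submodule.coe_add, Pi.add_apply, indicator_of_mem hz]
      rw [deriv_add hf hg, mul_add]
    · simp [indicator_of_notMem hz]
  map_smul' c f := by
    refine Subtype.ext (funext fun z => ?_)
    by_cases hz : z ∈ logSector a b
    · have hf := f.2.1.differentiableAt ((isOpen_logSector a b).mem_nhds hz)
      simp only [Submodule.coe_smul, Pi.smul_apply, indicator_of_mem hz, RingHom.id_apply]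
      rw [deriv_const_smul c hf, smul_eq_mul, smul_eq_mul]
      ring
    · simp [indicator_of_notMem hz]

/-! ### The weighted spaces -/

/-- `ℰ(U)`: all partial derivatives on the relatively compact open subsets of `U`. -/
def settingE {d : ℕ} (U : TopologicalSpace.Opens (EuclideanSpace ℝ (Fin d))) : Setting where
  V := smoothFun U
  I := {O : TopologicalSpace.Opens (EuclideanSpace ℝ (Fin d)) //
    IsCompact (closure (O : Set (EuclideanSpace ℝ (Fin d)))) ∧
      closure (O : Set (EuclideanSpace ℝ (Fin d))) ⊆ U}
  L O := smoothFun O.1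
  res O := smoothRes (subset_closure.trans O.2.2)
  A O n := O.1 × (Fin n → Fin d)
  ev _ _ a := partialDeriv a.1 a.2

/-- `ℬ(U)`: all partial derivatives on the whole of `U`. -/
def settingB {d : ℕ} (U : TopologicalSpace.Opens (EuclideanSpace ℝ (Fin d))) : Setting where
  V := smoothFun U
  I := Unit
  L _ := smoothFun U
  res _ := LinearMap.id
  A _ n := U × (Fin n → Fin d)
  ev _ _ a := partialDeriv a.1 a.2

/-- `𝒜(S)`: all complex derivatives on the sector `S = {ζ : a < arg ζ < b}`. -/
def settingA (a b : ℝ) : Setting where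
  V := holoFun a b
  I := Unit
  L _ := holoFun a b
  res _ := LinearMap.id
  A _ _ := logSector a b
  ev _ n z := (LinearMap.proj z.1).comp ((holoFun a b).subtype.comp (sectorDeriv a b ^ n))

/-- `𝒮(ℝ^d)`: the quantities `(1 + |x|)^k ∂^β f(x)` with `k + |β| = n`. -/
def settingS (d : ℕ) : Setting where
  V := smoothFun (⊤ : TopologicalSpace.Opens (EuclideanSpace ℝ (Fin d)))
  I := Unit
  L _ := smoothFun (⊤ : TopologicalSpace.Opens (EuclideanSpace ℝ (Fin d)))
  res _ := LinearMap.id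
  A _ n := EuclideanSpace ℝ (Fin d) × {kv : ℕ × (Σ j : ℕ, Fin j → Fin d) // kv.1 + kv.2.1 = n}
  ev _ _ a := ((1 + ‖a.1‖ : ℝ) ^ a.2.1.1 : ℂ) •
    partialDeriv (U := ⊤) ⟨a.1, trivial⟩ a.2.1.2.2

/-- `Λ`: sequences of complex numbers. -/
def settingLambda : Setting where
  V := ℕ → ℂ
  I := Unit
  L _ := ℕ → ℂ
  res _ := LinearMap.id
  A _ _ := Unit
  ev _ n _ := LinearMap.proj n

/-- `ℱ`: formal power series in `d` variables with complex coefficients. -/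
def settingF (d : ℕ) : Setting where
  V := MvPowerSeries (Fin d) ℂ
  I := Unit
  L _ := MvPowerSeries (Fin d) ℂ
  res _ := LinearMap.id
  A _ n := {β : Fin d →₀ ℕ // β.degree = n}
  ev _ _ β := MvPowerSeries.coeff β.1

/-- The symbols `ℰ, ℬ, 𝒜, 𝒮, Λ, ℱ`, together with the domains of definition. -/
inductive SpaceSymbol : Type
  | E (d : ℕ) (U : TopologicalSpace.Opens (EuclideanSpace ℝ (Fin d)))
  | B (d : ℕ) (U : TopologicalSpace.Opens (EuclideanSpace ℝ (Fin d)))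
  | A (a b : ℝ)
  | S (d : ℕ)
  | Lambda
  | F (d : ℕ)

/-- The data belonging to a symbol. -/
def SpaceSymbol.setting : SpaceSymbol → Setting
  | .E _ U => settingE U
  | .B _ U => settingB U
  | .A a b => settingA a b
  | .S d => settingS d
  | .Lambda => settingLambda
  | .F d => settingF d

/-- The two types of weighted spaces, `{·}` (Roumieu) and `(·)` (Beurling). -/
inductive Kind : Type
  | roumieu
  | beurling

/-- The weighted space of a given symbol and type for a scale of weight sequences. -/
def SpaceSymbol.space (𝔉 : SpaceSymbol) (κ : Kind) (𝒲 : Set (ℕ → ℝ)) : LCSubspace 𝔉.setting.V :=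
  match κ with
  | .roumieu => 𝔉.setting.roumieu 𝒲
  | .beurling => 𝔉.setting.beurling 𝒲

/-- `𝔉_[ℳ]` for a weight matrix `ℳ`. -/
def SpaceSymbol.matrixSpace (𝔉 : SpaceSymbol) (κ : Kind) (M : ℝ → ℕ → ℝ) : LCSubspace 𝔉.setting.V :=
  𝔉.space κ (matrixScale M)

/-- `𝔉_[σ]` for a weight function `σ`. -/
def SpaceSymbol.functionSpace (𝔉 : SpaceSymbol) (κ : Kind) (σ : ℝ → ℝ) : LCSubspace 𝔉.setting.V :=
  𝔉.space κ (functionScale σ)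

end WeightedSpaces

end

open WeightedSpaces

/-! All spaces are built from a scale of weight sequences and depend on it only up to equivalence:
domination of each weight of one scale by a weight of the other handles the Roumieu type, minoration
handles the Beurling type. So the theorem is about scales, and the weight `v = ω ⋆̂ id^{1/α}` serves
as the common reference.

Two weight functions that bound each other up to a factor and an additive constant have equivalent
scales, because the factor only rescales the index `ℓ`. Now `ω_{W^(ℓ)}` is comparable to `ω`
(`IsBMTWeight.assocFun_le`, `IsBMTWeight.le_assocFun`), `ω_{G^α}(t)` is comparable to `t^{1/α}`, and
`ω_{W^(ℓ)/G^α}` is `ω_{W^(ℓ)} ⋆̂ ω_{G^α}` up to a dilation. Hence every candidate is comparable to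
`v` up to a dilation of the argument. Growth (ii) makes the suprema finite.

Dilations are absorbed by (i). If `γ(W^(ℓ₀)) > α`, then `ω(kt) ≤ C ω(t) + D` with `C < k^{1/α}`
(`IsBMTWeight.slowDilation`). Conjugation turns this into `v(rt) ≤ C v(t) + D` with `r = k/C^α > 1`,
and iteration reaches every dilation (`IsBMTWeight.stableUnderDilation`). The same stability absorbs
the factors `h^p` of the matrix scale.

It remains to compare `W^(ℓ)/G^α` with the sequences of `v`. One bound comes from testing the
supremum that defines `v` (`logWeight_upperConj_le`). For the other, (i) makes `W^(ℓ₀)/G^α`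
equivalent to a log-convex sequence, which is recovered from its associated function
(`log_quotientMatrix_le_logWeight`). Homogeneity of the conjugate carries this from `ℓ₀` to all `ℓ`,
with an index linear in `ℓ` (`exists_log_quotientMatrix_le`); linearity lets one estimate serve
large and small indices, thus both types. -/

noncomputable section

namespace WeightedSpaces

/-! ### Comparison of scales -/

section Scales

/-- Every weight in `𝒱` is dominated by a weight in `𝒲`, up to a constant. -/
def DominatedScale (𝒱 𝒲 : Set (ℕ → ℝ)) : Prop :=
  ∀ w ∈ 𝒱, ∃ w' ∈ 𝒲, ∃ C : ℝ, ∀ n, w n ≤ C * w' n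

/-- Every weight in `𝒲` dominates a weight in `𝒱`, up to a constant. -/
def MinoratedScale (𝒱 𝒲 : Set (ℕ → ℝ)) : Prop :=
  ∀ w' ∈ 𝒲, ∃ w ∈ 𝒱, ∃ C : ℝ, ∀ n, w n ≤ C * w' n

/-- Equivalence of scales of positive weight sequences, for both types of spaces. -/
structure ScaleEquiv (𝒱 𝒲 : Set (ℕ → ℝ)) : Prop where
  pos_left : ∀ w ∈ 𝒱, ∀ n, 0 < w n
  pos_right : ∀ w ∈ 𝒲, ∀ n, 0 < w n
  dominated : DominatedScale 𝒱 𝒲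
  dominated' : DominatedScale 𝒲 𝒱
  minorated : MinoratedScale 𝒱 𝒲
  minorated' : MinoratedScale 𝒲 𝒱

theorem ScaleEquiv.symm {𝒱 𝒲 : Set (ℕ → ℝ)} (h : ScaleEquiv 𝒱 𝒲) : ScaleEquiv 𝒲 𝒱 :=
  ⟨h.pos_right, h.pos_left, h.dominated', h.dominated, h.minorated', h.minorated⟩

theorem DominatedScale.trans {𝒰 𝒱 𝒲 : Set (ℕ → ℝ)} (h : DominatedScale 𝒰 𝒱)
    (h' : DominatedScale 𝒱 𝒲) (hpos : ∀ w ∈ 𝒱, ∀ n, 0 < w n) : DominatedScale 𝒰 𝒲 := by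
  intro w hw
  obtain ⟨v, hv, C, hC⟩ := h w hw
  obtain ⟨u, hu, D, hD⟩ := h' v hv
  refine ⟨u, hu, |C| * D, fun n => (hC n).trans ?_⟩
  rw [mul_assoc]
  exact (mul_le_mul_of_nonneg_right (le_abs_self C) (hpos v hv n).le).trans
    (mul_le_mul_of_nonneg_left (hD n) (abs_nonneg C))

theorem MinoratedScale.trans {𝒰 𝒱 𝒲 : Set (ℕ → ℝ)} (h : MinoratedScale 𝒰 𝒱)
    (h' : MinoratedScale 𝒱 𝒲) (hpos : ∀ w ∈ 𝒱, ∀ n, 0 < w n) : MinoratedScale 𝒰 𝒲 := by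
  intro u hu
  obtain ⟨v, hv, C, hC⟩ := h' u hu
  obtain ⟨w, hw, D, hD⟩ := h v hv
  refine ⟨w, hw, |D| * C, fun n => (hD n).trans ?_⟩
  rw [mul_assoc]
  exact (mul_le_mul_of_nonneg_right (le_abs_self D) (hpos v hv n).le).trans
    (mul_le_mul_of_nonneg_left (hC n) (abs_nonneg D))

theorem ScaleEquiv.trans {𝒰 𝒱 𝒲 : Set (ℕ → ℝ)} (h : ScaleEquiv 𝒰 𝒱) (h' : ScaleEquiv 𝒱 𝒲) :
    ScaleEquiv 𝒰 𝒲 :=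
  ⟨h.pos_left, h'.pos_right, h.dominated.trans h'.dominated h.pos_right,
    h'.dominated'.trans h.dominated' h.pos_right, h.minorated.trans h'.minorated h.pos_right,
    h'.minorated'.trans h.minorated' h.pos_right⟩

/-! ### Invariance of the spaces under equivalence of scales -/

namespace Setting

variable (S : Setting) {i : S.I} {w w' : ℕ → ℝ}

theorem step_le_step {C : ℝ} (hw' : ∀ n, 0 < w' n) (h : ∀ n, w n ≤ C * w' n) :
    S.step i w ≤ S.step i w' := by
  rintro f ⟨D, hD, hf⟩
  refine ⟨D * |C|, by positivity, fun n a => (hf n a).trans ?_⟩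
  rw [mul_assoc]
  exact mul_le_mul_of_nonneg_left
    ((h n).trans (mul_le_mul_of_nonneg_right (le_abs_self C) (hw' n).le)) hD

theorem stepNorm_nonneg {f : S.L i} (hf : f ∈ S.step i w) : 0 ≤ S.stepNorm i w f :=
  Real.iSup_nonneg fun x => S.div_nonneg_of_mem i w hf x

theorem stepNorm_le_mul {C : ℝ} (hw : ∀ n, 0 < w n) (hw' : ∀ n, 0 < w' n)
    (h : ∀ n, w n ≤ C * w' n) {f : S.L i} (hf : f ∈ S.step i w) :
    S.stepNorm i w' f ≤ |C| * S.stepNorm i w f := by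
  refine Real.iSup_le (fun x => ?_) (mul_nonneg (abs_nonneg C) (S.stepNorm_nonneg hf))
  refine le_trans ?_ (mul_le_mul_of_nonneg_left (le_ciSup (S.bddAbove_of_mem i w hf) x)
    (abs_nonneg C))
  rw [← mul_div_assoc, div_le_div_iff₀ (hw' _) (hw _)]
  have h1 : w x.1 ≤ |C| * w' x.1 :=
    (h _).trans (mul_le_mul_of_nonneg_right (le_abs_self C) (hw' _).le)
  nlinarith [mul_le_mul_of_nonneg_left h1 (norm_nonneg (S.ev i x.1 x.2 f))]

theorem union_mono {𝒱 𝒲 : Set (ℕ → ℝ)} (hpos : ∀ w ∈ 𝒲, ∀ n, 0 < w n)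
    (h : DominatedScale 𝒱 𝒲) : S.union i 𝒱 ≤ S.union i 𝒲 := by
  refine iSup₂_le fun w hw => ?_
  obtain ⟨w', hw', C, hC⟩ := h w hw
  exact (S.step_le_step (hpos w' hw') hC).trans (le_iSup₂_of_le w' hw' le_rfl)

/-- Each step for `𝒱` embeds continuously into a step for `𝒲`, so continuity on the steps is
inherited. -/
theorem comp_inclusion_mem_unionSeminorms {𝒱 𝒲 : Set (ℕ → ℝ)} (h𝒱 : ∀ w ∈ 𝒱, ∀ n, 0 < w n)
    (h𝒲 : ∀ w ∈ 𝒲, ∀ n, 0 < w n) (h : DominatedScale 𝒱 𝒲) (hle : S.union i 𝒱 ≤ S.union i 𝒲)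
    {q : Seminorm ℂ (S.union i 𝒲)} (hq : q ∈ S.unionSeminorms i 𝒲) :
    q.comp (Submodule.inclusion hle) ∈ S.unionSeminorms i 𝒱 := by
  intro w hw
  obtain ⟨w', hw', C, hC⟩ := h w hw
  obtain ⟨D, hD⟩ := hq w' hw'
  refine ⟨|D| * |C|, fun f hf => ?_⟩
  have hf' : f.1 ∈ S.step i w' := S.step_le_step (h𝒲 w' hw') hC hf
  rw [Seminorm.comp_apply]
  have hD' := hD (Submodule.inclusion hle f)
  rw [Submodule.coe_inclusion] at hD'
  calc q (Submodule.inclusion hle f) ≤ D * S.stepNorm i w' f.1 := hD' hf'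
    _ ≤ |D| * S.stepNorm i w' f.1 :=
        mul_le_mul_of_nonneg_right (le_abs_self D) (S.stepNorm_nonneg hf')
    _ ≤ |D| * (|C| * S.stepNorm i w f.1) :=
        mul_le_mul_of_nonneg_left (S.stepNorm_le_mul (h𝒱 w hw) (h𝒲 w' hw') hC hf) (abs_nonneg D)
    _ = |D| * |C| * S.stepNorm i w f.1 := by ring

/-- The intersection of the preimages of the subspaces `X i` of `L i`. -/
def projCarrier (X : ∀ i, Σ U : Submodule ℂ (S.L i), Set (Seminorm ℂ U)) : Submodule ℂ S.V :=
  ⨅ i, (X i).1.comap (S.res i)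

/-- The restriction map to the `i`-th subspace. -/
def projRes (X : ∀ i, Σ U : Submodule ℂ (S.L i), Set (Seminorm ℂ U)) (i : S.I) :
    S.projCarrier X →ₗ[ℂ] (X i).1 :=
  ((S.res i).comp (S.projCarrier X).subtype).codRestrict (X i).1
    (fun f => (Submodule.mem_iInf _).1 f.2 i)

/-- The projective limit over `i` of subspaces of `L i` with topologies generated by sets of
seminorms. -/
def projLimit (X : ∀ i, Σ U : Submodule ℂ (S.L i), Set (Seminorm ℂ U)) : LCSubspace S.V :=
  LCSubspace.ofSeminorms (S.projCarrier X)
    {q | ∃ i, ∃ q' ∈ (X i).2, q = q'.comp (S.projRes X i)}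

/-- Carrier and seminorms enter as one dependent pair, so an equality of pairs can be rewritten
inside the limit without transport between subspaces. -/
theorem roumieu_eq_projLimit (𝒲 : Set (ℕ → ℝ)) :
    S.roumieu 𝒲 = S.projLimit (fun i => ⟨S.union i 𝒲, S.unionSeminorms i 𝒲⟩) := rfl

theorem sigma_seminorms_ext {E : Type} [AddCommGroup E] [Module ℂ E] {U U' : Submodule ℂ E}
    {Q : Set (Seminorm ℂ U)} {Q' : Set (Seminorm ℂ U')} (h : U ≤ U') (h' : U' ≤ U)
    (hQ : ∀ q ∈ Q', q.comp (Submodule.inclusion h) ∈ Q)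
    (hQ' : ∀ q ∈ Q, q.comp (Submodule.inclusion h') ∈ Q') :
    (⟨U, Q⟩ : Σ U : Submodule ℂ E, Set (Seminorm ℂ U)) = ⟨U', Q'⟩ := by
  obtain rfl := le_antisymm h h'
  congr 1
  -- Once the subspaces are identified, composition with the inclusion is definitionally the
  -- identity.
  exact Subset.antisymm (fun q hq => hQ' q hq) (fun q hq => hQ q hq)

theorem roumieu_congr {𝒱 𝒲 : Set (ℕ → ℝ)} (h : ScaleEquiv 𝒱 𝒲) : S.roumieu 𝒱 = S.roumieu 𝒲 := by
  have key : (fun i => (⟨S.union i 𝒱, S.unionSeminorms i 𝒱⟩ :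
      Σ U : Submodule ℂ (S.L i), Set (Seminorm ℂ U))) =
      fun i => ⟨S.union i 𝒲, S.unionSeminorms i 𝒲⟩ := by
    funext i
    have h1 : S.union i 𝒱 ≤ S.union i 𝒲 := S.union_mono h.pos_right h.dominated
    have h2 : S.union i 𝒲 ≤ S.union i 𝒱 := S.union_mono h.pos_left h.dominated'
    exact sigma_seminorms_ext h1 h2
      (fun q hq => S.comp_inclusion_mem_unionSeminorms h.pos_left h.pos_right h.dominated h1 hq)
      (fun q hq => S.comp_inclusion_mem_unionSeminorms h.pos_right h.pos_left h.dominated' h2 hq)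
  rw [roumieu_eq_projLimit, roumieu_eq_projLimit, key]

theorem stepSeminorm_apply (f : S.step i w) : S.stepSeminorm i w f = S.stepNorm i w f.1 := rfl

theorem beurlingRes_coe (𝒲 : Set (ℕ → ℝ)) (w : 𝒲) (f : S.beurlingCarrier 𝒲) :
    (S.beurlingRes i 𝒲 w f).1 = S.res i f.1 := rfl

theorem beurlingCarrier_le {𝒱 𝒲 : Set (ℕ → ℝ)} (hpos : ∀ w ∈ 𝒲, ∀ n, 0 < w n)
    (h : MinoratedScale 𝒱 𝒲) : S.beurlingCarrier 𝒱 ≤ S.beurlingCarrier 𝒲 := by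
  refine le_iInf fun i => le_iInf fun w' => ?_
  obtain ⟨w, hw, C, hC⟩ := h w'.1 w'.2
  exact (iInf_le_of_le i (iInf_le_of_le (⟨w, hw⟩ : 𝒱) le_rfl)).trans
    (Submodule.comap_mono (S.step_le_step (hpos w'.1 w'.2) hC))

theorem _root_.WeightedSpaces.LCSubspace.ofSeminorms_congr {V : Type} [AddCommGroup V] [Module ℂ V]
    {W W' : Submodule ℂ V} {P : Set (Seminorm ℂ W)} {P' : Set (Seminorm ℂ W')}
    (h : W ≤ W') (h' : W' ≤ W)
    (hP : ∀ p ∈ P, ∃ p' ∈ P', ∃ C : ℝ, ∀ f, p f ≤ C * p' (Submodule.inclusion h f))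
    (hP' : ∀ p' ∈ P', ∃ p ∈ P, ∃ C : ℝ, ∀ f, p' f ≤ C * p (Submodule.inclusion h' f)) :
    LCSubspace.ofSeminorms W P = LCSubspace.ofSeminorms W' P' := by
  obtain rfl := le_antisymm h h'
  have aux : ∀ {P Q : Set (Seminorm ℂ W)},
      (∀ p ∈ P, ∃ q ∈ Q, ∃ C : ℝ, ∀ f, p f ≤ C * q f) →
      Seminorm.IsBounded (fun q : Q => (q : Seminorm ℂ W)) (fun p : P => (p : Seminorm ℂ W))
        LinearMap.id := by
    intro P Q hPQ p
    obtain ⟨q, hq, C, hC⟩ := hPQ p.1 p.2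
    refine ⟨{⟨q, hq⟩}, ⟨|C|, abs_nonneg C⟩, fun f => ?_⟩
    rw [Finset.sup_singleton]
    exact (hC f).trans (mul_le_mul_of_nonneg_right (le_abs_self C) (apply_nonneg q f))
  have ht : (SeminormFamily.moduleFilterBasis (fun p : P => (p : Seminorm ℂ W))).topology =
      (SeminormFamily.moduleFilterBasis (fun p : P' => (p : Seminorm ℂ W))).topology := by
    let _ := (SeminormFamily.moduleFilterBasis (fun p : P => (p : Seminorm ℂ W))).topology
    have hws : WithSeminorms (fun p : P => (p : Seminorm ℂ W)) := ⟨rfl⟩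
    exact (hws.congr (aux hP') (aux hP)).topology_eq_withSeminorms
  unfold LCSubspace.ofSeminorms
  congr 1

/-- The seminorms that define the topology of the Beurling type space. -/
def beurlingSeminorms (𝒲 : Set (ℕ → ℝ)) : Set (Seminorm ℂ (S.beurlingCarrier 𝒲)) :=
  {q | ∃ i, ∃ w : 𝒲, q = (S.stepSeminorm i w.1).comp (S.beurlingRes i 𝒲 w)}

theorem beurling_eq (𝒲 : Set (ℕ → ℝ)) :
    S.beurling 𝒲 = LCSubspace.ofSeminorms (S.beurlingCarrier 𝒲) (S.beurlingSeminorms 𝒲) := rfl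

/-- A smaller weight gives a larger norm, so a seminorm for `𝒱` is controlled by means of a weight
of `𝒲` below the given one. -/
theorem exists_beurlingSeminorms_le {𝒱 𝒲 : Set (ℕ → ℝ)} (h𝒱 : ∀ w ∈ 𝒱, ∀ n, 0 < w n)
    (h𝒲 : ∀ w ∈ 𝒲, ∀ n, 0 < w n) (h : MinoratedScale 𝒲 𝒱)
    (hle : S.beurlingCarrier 𝒱 ≤ S.beurlingCarrier 𝒲) (p : Seminorm ℂ (S.beurlingCarrier 𝒱))
    (hp : p ∈ S.beurlingSeminorms 𝒱) :
    ∃ p' ∈ S.beurlingSeminorms 𝒲, ∃ C : ℝ, ∀ f, p f ≤ C * p' (Submodule.inclusion hle f) := by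
  obtain ⟨i, w, rfl⟩ := hp
  obtain ⟨w', hw', C, hC⟩ := h w.1 w.2
  refine ⟨(S.stepSeminorm i w').comp (S.beurlingRes i 𝒲 ⟨w', hw'⟩), ⟨i, ⟨w', hw'⟩, rfl⟩, |C|,
    fun f => ?_⟩
  have hf := (S.beurlingRes i 𝒲 ⟨w', hw'⟩ (Submodule.inclusion hle f)).2
  rw [beurlingRes_coe, Submodule.coe_inclusion] at hf
  have key := S.stepNorm_le_mul (h𝒲 w' hw') (h𝒱 w.1 w.2) hC hf
  rw [Seminorm.comp_apply, Seminorm.comp_apply, stepSeminorm_apply, stepSeminorm_apply,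
    beurlingRes_coe, beurlingRes_coe, Submodule.coe_inclusion]
  exact key

theorem beurling_congr {𝒱 𝒲 : Set (ℕ → ℝ)} (h : ScaleEquiv 𝒱 𝒲) :
    S.beurling 𝒱 = S.beurling 𝒲 := by
  rw [beurling_eq, beurling_eq]
  exact LCSubspace.ofSeminorms_congr (S.beurlingCarrier_le h.pos_right h.minorated)
    (S.beurlingCarrier_le h.pos_left h.minorated')
    (S.exists_beurlingSeminorms_le h.pos_left h.pos_right h.minorated' _)
    (S.exists_beurlingSeminorms_le h.pos_right h.pos_left h.minorated _)

end Setting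

theorem SpaceSymbol.space_congr (𝔉 : SpaceSymbol) (κ : Kind) {𝒱 𝒲 : Set (ℕ → ℝ)}
    (h : ScaleEquiv 𝒱 𝒲) : 𝔉.space κ 𝒱 = 𝔉.space κ 𝒲 := by
  cases κ
  · exact 𝔉.setting.roumieu_congr h
  · exact 𝔉.setting.beurling_congr h

end Scales

/-! ### Conjugates and weight sequences of weight functions -/

section Young

/-- A function that is nonnegative on `[0, +∞)` and dominates the logarithm. -/
structure DominatesLog (σ : ℝ → ℝ) : Prop where
  nonneg : ∀ t, 0 ≤ t → 0 ≤ σ t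
  log_isLittleO : Real.log =o[atTop] σ

theorem IsBMTWeight.nonneg {ω : ℝ → ℝ} (hω : IsBMTWeight ω) {t : ℝ} (ht : 0 ≤ t) : 0 ≤ ω t := by
  rw [← hω.normalized 0 le_rfl zero_le_one]
  exact hω.mono self_mem_Ici ht ht

theorem IsBMTWeight.dominatesLog {ω : ℝ → ℝ} (hω : IsBMTWeight ω) : DominatesLog ω :=
  ⟨fun _ ht => hω.nonneg ht, hω.log_isLittleO⟩

/-- `φ*_σ(ℓ x) / ℓ`, the logarithm of the associated weight matrix for real exponents `x`. -/
def logWeight (σ : ℝ → ℝ) (ℓ x : ℝ) : ℝ := 1 / ℓ * youngConj σ (ℓ * x)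

theorem assocMatrix_eq_exp (σ : ℝ → ℝ) (ℓ : ℝ) (p : ℕ) :
    assocMatrix σ ℓ p = Real.exp (logWeight σ ℓ p) := rfl

theorem assocMatrix_pos (σ : ℝ → ℝ) (ℓ : ℝ) (p : ℕ) : 0 < assocMatrix σ ℓ p := Real.exp_pos _

theorem log_assocMatrix (σ : ℝ → ℝ) (ℓ : ℝ) (p : ℕ) :
    Real.log (assocMatrix σ ℓ p) = logWeight σ ℓ p := Real.log_exp _

theorem DominatesLog.bddAbove {σ : ℝ → ℝ} (hσ : DominatesLog σ) {x : ℝ} (hx : 0 ≤ x) :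
    BddAbove (range fun y : ℝ => x * y - σ (Real.exp y)) := by
  -- This constant gives `(x + 1)|y| ≤ σ(e^y)` for `e^y ≥ T`, so the terms there are at most `0`; `x
  -- + 1` also covers `x = 0`.
  have h := hσ.log_isLittleO.def (c := 1 / (x + 1)) (by positivity)
  obtain ⟨T, hT⟩ := eventually_atTop.1 h
  refine ⟨x * max 0 (Real.log (max T 1)), ?_⟩
  rintro _ ⟨y, rfl⟩
  have h0 := hσ.nonneg _ (Real.exp_pos y).le
  by_cases hy : T ≤ Real.exp y
  · have h1 := hT _ hy
    rw [Real.log_exp, Real.norm_eq_abs, Real.norm_eq_abs, abs_of_nonneg h0, div_mul_eq_mul_div,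
      one_mul, le_div_iff₀ (by positivity)] at h1
    have h2 : x * y ≤ σ (Real.exp y) := by nlinarith [le_abs_self y, abs_nonneg y]
    have h3 : 0 ≤ x * max 0 (Real.log (max T 1)) := mul_nonneg hx (le_max_left _ _)
    simp only
    linarith
  · have h1 : y ≤ Real.log (max T 1) := by
      rw [Real.le_log_iff_exp_le (by positivity)]
      exact (not_le.1 hy).le.trans (le_max_left _ _)
    have h2 : x * y ≤ x * max 0 (Real.log (max T 1)) :=
      mul_le_mul_of_nonneg_left (h1.trans (le_max_right _ _)) hx
    simp only
    linarith

theorem DominatesLog.le_youngConj {σ : ℝ → ℝ} (hσ : DominatesLog σ) {x : ℝ} (hx : 0 ≤ x) (y : ℝ) :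
    x * y - σ (Real.exp y) ≤ youngConj σ x :=
  le_csSup (hσ.bddAbove hx) ⟨y, rfl⟩

theorem youngConj_le {σ : ℝ → ℝ} {x B : ℝ} (h : ∀ y, x * y - σ (Real.exp y) ≤ B) :
    youngConj σ x ≤ B :=
  csSup_le (range_nonempty _) (by rintro _ ⟨y, rfl⟩; exact h y)

theorem DominatesLog.le_logWeight {σ : ℝ → ℝ} (hσ : DominatesLog σ) {ℓ x : ℝ} (hℓ : 0 < ℓ)
    (hx : 0 ≤ x) (y : ℝ) : x * y - σ (Real.exp y) / ℓ ≤ logWeight σ ℓ x := by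
  have h := hσ.le_youngConj (mul_nonneg hℓ.le hx) y
  rw [logWeight, one_div_mul_eq_div, le_div_iff₀ hℓ]
  calc _ = ℓ * x * y - σ (Real.exp y) := by field_simp
    _ ≤ _ := h

theorem logWeight_le {σ : ℝ → ℝ} {ℓ x B : ℝ} (hℓ : 0 < ℓ)
    (h : ∀ y, x * y - σ (Real.exp y) / ℓ ≤ B) : logWeight σ ℓ x ≤ B := by
  rw [logWeight, one_div_mul_eq_div, div_le_iff₀ hℓ]
  refine youngConj_le fun y => ?_
  calc _ = (x * y - σ (Real.exp y) / ℓ) * ℓ := by field_simp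
    _ ≤ _ := mul_le_mul_of_nonneg_right (h y) hℓ.le

/-- Homogeneity trades a factor of the exponent for a factor of the index; changes of `ℓ` rest on
it. -/
theorem logWeight_mul (σ : ℝ → ℝ) {ℓ c : ℝ} (hc : 0 < c) (x : ℝ) :
    logWeight σ ℓ (c * x) = c * logWeight σ (c * ℓ) x := by
  have h : ℓ * (c * x) = c * ℓ * x := by ring
  rw [logWeight, logWeight, h]
  rcases eq_or_ne ℓ 0 with rfl | hℓ
  -- For `ℓ = 0` both sides vanish, since `1 / 0 = 0`.
  · simp
  · field_simp

theorem DominatesLog.logWeight_mono {σ : ℝ → ℝ} (hσ : DominatesLog σ) {ℓ ℓ' x : ℝ} (hℓ : 0 < ℓ)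
    (h : ℓ ≤ ℓ') (hx : 0 ≤ x) : logWeight σ ℓ x ≤ logWeight σ ℓ' x := by
  refine logWeight_le hℓ fun y => ?_
  have h1 := hσ.le_logWeight (hℓ.trans_le h) hx y
  have h2 : σ (Real.exp y) / ℓ' ≤ σ (Real.exp y) / ℓ :=
    div_le_div_of_nonneg_left (hσ.nonneg _ (Real.exp_pos y).le) hℓ h
  linarith

/-- A bound `σ(t) ≤ C τ(t / h) + D` yields a converse bound for the weight matrices. -/
theorem DominatesLog.logWeight_le_of_le {σ τ : ℝ → ℝ} (hσ : DominatesLog σ) {C D h : ℝ}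
    (hC : 0 < C) (hh : 0 < h) (hle : ∀ t, 0 < t → σ t ≤ C * τ (t / h) + D) {ℓ x : ℝ} (hℓ : 0 < ℓ)
    (hx : 0 ≤ x) :
    x * Real.log h + logWeight τ ℓ x ≤ D / (C * ℓ) + logWeight σ (C * ℓ) x := by
  rw [← le_sub_iff_add_le']
  -- The conjugate of `σ` is tested at `y + log h`; the shift produces the term `x log h`.
  refine logWeight_le hℓ fun y => ?_
  have h1 := hσ.le_logWeight (mul_pos hC hℓ) hx (y + Real.log h)
  have h2 := hle (Real.exp (y + Real.log h)) (Real.exp_pos _)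
  have h3 : Real.exp (y + Real.log h) / h = Real.exp y := by
    rw [Real.exp_add, Real.exp_log hh]
    field_simp
  rw [h3] at h2
  have h4 : σ (Real.exp (y + Real.log h)) / (C * ℓ) ≤ τ (Real.exp y) / ℓ + D / (C * ℓ) := by
    rw [div_le_iff₀ (mul_pos hC hℓ)]
    calc _ ≤ _ := h2
      _ = _ := by field_simp
  linarith [mul_add x y (Real.log h)]

/-- `σ(t) = O(τ(t)) + O(1)` on `(0, +∞)`. -/
def LeUpToConst (σ τ : ℝ → ℝ) : Prop := ∃ C D : ℝ, 0 < C ∧ ∀ t, 0 < t → σ t ≤ C * τ t + D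

theorem LeUpToConst.trans {ρ σ τ : ℝ → ℝ} (h : LeUpToConst ρ σ) (h' : LeUpToConst σ τ) :
    LeUpToConst ρ τ := by
  obtain ⟨C, D, hC, h⟩ := h
  obtain ⟨C', D', hC', h'⟩ := h'
  refine ⟨C * C', C * D' + D, by positivity, fun t ht => ?_⟩
  nlinarith [h t ht, h' t ht]

theorem DominatesLog.of_leUpToConst {σ τ : ℝ → ℝ} (hσ : DominatesLog σ) (h : LeUpToConst σ τ)
    (hτ : ∀ t, 0 ≤ t → 0 ≤ τ t) : DominatesLog τ := by
  refine ⟨hτ, isLittleO_iff.2 fun ε hε => ?_⟩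
  obtain ⟨C, D, hC, h⟩ := h
  have h1 := hσ.log_isLittleO.def (c := ε / (2 * C)) (by positivity)
  -- The additive constant then costs at most `(log t) / 2`, which is absorbed on the left; hence
  -- the `2` in `ε / (2 * C)`.
  have h2 : ∀ᶠ t in atTop, D * ε / C ≤ Real.log t := Real.tendsto_log_atTop.eventually_ge_atTop _
  filter_upwards [h1, h2, eventually_gt_atTop 1] with t h1 h2 h3
  have hlog : 0 < Real.log t := Real.log_pos h3
  have ht : 0 < t := by linarith
  rw [Real.norm_eq_abs, Real.norm_eq_abs, abs_of_pos hlog, abs_of_nonneg (hσ.nonneg _ ht.le)] at h1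
  rw [Real.norm_eq_abs, Real.norm_eq_abs, abs_of_pos hlog, abs_of_nonneg (hτ _ ht.le)]
  have h4 : ε / (2 * C) * σ t ≤ ε / (2 * C) * (C * τ t + D) :=
    mul_le_mul_of_nonneg_left (h t ht) (by positivity)
  have h5 : ε / (2 * C) * (C * τ t + D) = ε * τ t / 2 + D * ε / C / 2 := by field_simp
  linarith

theorem DominatesLog.tendsto {σ : ℝ → ℝ} (hσ : DominatesLog σ) : Tendsto σ atTop atTop := by
  refine tendsto_atTop_mono' _ ?_ Real.tendsto_log_atTop
  filter_upwards [hσ.log_isLittleO.def one_pos, eventually_ge_atTop 0] with t ht h0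
  rw [one_mul, Real.norm_eq_abs, Real.norm_eq_abs, abs_of_nonneg (hσ.nonneg _ h0)] at ht
  exact (le_abs_self _).trans ht

theorem functionScale_pos (σ : ℝ → ℝ) : ∀ w ∈ functionScale σ, ∀ n, 0 < w n := by
  rintro _ ⟨ℓ, _, rfl⟩ n
  exact assocMatrix_pos σ ℓ n

theorem DominatesLog.assocMatrix_le {σ τ : ℝ → ℝ} (hσ : DominatesLog σ) {C D : ℝ}
    (hC : 0 < C) (hle : ∀ t, 0 < t → σ t ≤ C * τ t + D) {ℓ : ℝ} (hℓ : 0 < ℓ) (n : ℕ) :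
    assocMatrix τ ℓ n ≤ Real.exp (D / (C * ℓ)) * assocMatrix σ (C * ℓ) n := by
  rw [assocMatrix_eq_exp, assocMatrix_eq_exp, ← Real.exp_add, Real.exp_le_exp]
  have := hσ.logWeight_le_of_le (τ := τ) hC one_pos (fun t ht => by rw [div_one]; exact hle t ht)
    hℓ (Nat.cast_nonneg n)
  simpa using this

theorem DominatesLog.dominatedScale {σ τ : ℝ → ℝ} (hσ : DominatesLog σ) (h : LeUpToConst σ τ) :
    DominatedScale (functionScale τ) (functionScale σ) := by
  obtain ⟨C, D, hC, h⟩ := h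
  rintro _ ⟨ℓ, hℓ, rfl⟩
  exact ⟨_, ⟨C * ℓ, by positivity, rfl⟩, _, hσ.assocMatrix_le hC h hℓ⟩

theorem DominatesLog.minoratedScale {σ τ : ℝ → ℝ} (hσ : DominatesLog σ) (h : LeUpToConst σ τ) :
    MinoratedScale (functionScale τ) (functionScale σ) := by
  obtain ⟨C, D, hC, h⟩ := h
  rintro _ ⟨ℓ, hℓ, rfl⟩
  refine ⟨_, ⟨ℓ / C, by positivity, rfl⟩, Real.exp (D / (C * (ℓ / C))), fun n => ?_⟩
  have := hσ.assocMatrix_le hC h (div_pos hℓ hC) n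
  rwa [mul_div_cancel₀ _ hC.ne'] at this ⊢

theorem ScaleEquiv.of_leUpToConst {σ τ : ℝ → ℝ} (hσ : DominatesLog σ) (hτ : DominatesLog τ)
    (h : LeUpToConst σ τ) (h' : LeUpToConst τ σ) :
    ScaleEquiv (functionScale σ) (functionScale τ) :=
  ⟨functionScale_pos σ, functionScale_pos τ, hτ.dominatedScale h', hσ.dominatedScale h,
    hτ.minoratedScale h', hσ.minoratedScale h⟩

/-- The conjugate evaluates `σ` only at the points `e^y`, so conventions at `0` are irrelevant. -/
theorem functionScale_congr {σ τ : ℝ → ℝ} (h : ∀ t, 0 < t → σ t = τ t) :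
    functionScale σ = functionScale τ := by
  have : assocMatrix σ = assocMatrix τ := by
    funext ℓ p
    simp only [assocMatrix, youngConj, h _ (Real.exp_pos _)]
  rw [functionScale, functionScale, this]

end Young

/-! ### Associated weight functions -/

section AssocFun

theorem log_exp_pow_div {M : ℕ → ℝ} (hM : ∀ p, 0 < M p) (y : ℝ) (p : ℕ) :
    Real.log (Real.exp y ^ p / M p) = p * y - Real.log (M p) := by
  rw [Real.log_div (pow_pos (Real.exp_pos y) p).ne' (hM p).ne', Real.log_pow, Real.log_exp]

/-- For `p ≥ 1` this rests on the convention `Real.log 0 = 0`. -/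
theorem log_zero_pow_div {M : ℕ → ℝ} (h0 : M 0 = 1) (p : ℕ) : Real.log (0 ^ p / M p) = 0 := by
  rcases p with _ | p <;> simp [h0]

theorem assocFunFinite_of_forall {M : ℕ → ℝ} (hM : ∀ p, 0 < M p) (h0 : M 0 = 1)
    (h : ∀ y : ℝ, ∃ B, ∀ p : ℕ, p * y - Real.log (M p) ≤ B) : AssocFunFinite M := by
  intro t ht
  rcases ht.eq_or_lt with rfl | ht
  · exact ⟨0, by rintro _ ⟨p, rfl⟩; exact (log_zero_pow_div h0 p).le⟩
  · obtain ⟨B, hB⟩ := h (Real.log t)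
    refine ⟨B, ?_⟩
    rintro _ ⟨p, rfl⟩
    have := hB p
    rwa [← log_exp_pow_div hM, Real.exp_log ht] at this

theorem assocFun_zero {M : ℕ → ℝ} (h0 : M 0 = 1) : assocFun M 0 = 0 := by
  simp [assocFun, log_zero_pow_div h0]

theorem AssocFunFinite.le_assocFun {M : ℕ → ℝ} (hfin : AssocFunFinite M) (hM : ∀ p, 0 < M p)
    (y : ℝ) (p : ℕ) : p * y - Real.log (M p) ≤ assocFun M (Real.exp y) := by
  rw [← log_exp_pow_div hM]
  exact le_csSup (hfin _ (Real.exp_pos y).le) ⟨p, rfl⟩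

theorem assocFun_le {M : ℕ → ℝ} (hM : ∀ p, 0 < M p) {y B : ℝ}
    (h : ∀ p : ℕ, p * y - Real.log (M p) ≤ B) : assocFun M (Real.exp y) ≤ B := by
  refine csSup_le (range_nonempty _) ?_
  rintro _ ⟨p, rfl⟩
  exact (log_exp_pow_div hM y p).trans_le (h p)

theorem AssocFunFinite.nonneg {M : ℕ → ℝ} (hfin : AssocFunFinite M) (h0 : M 0 = 1) {t : ℝ}
    (ht : 0 ≤ t) : 0 ≤ assocFun M t := le_csSup (hfin t ht) ⟨0, by simp [h0]⟩

theorem AssocFunFinite.monotoneOn {M : ℕ → ℝ} (hfin : AssocFunFinite M) (hM : ∀ p, 0 < M p)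
    (h0 : M 0 = 1) : MonotoneOn (assocFun M) (Ici 0) := by
  intro s hs t ht hst
  rcases (show (0 : ℝ) ≤ s from hs).eq_or_lt with rfl | hs
  · rw [assocFun_zero h0]
    exact hfin.nonneg h0 ht
  · rw [← Real.exp_log hs]
    refine assocFun_le hM fun p => ?_
    have h1 := hfin.le_assocFun hM (Real.log t) p
    rw [Real.exp_log (hs.trans_le hst)] at h1
    have h2 : (p : ℝ) * Real.log s ≤ p * Real.log t :=
      mul_le_mul_of_nonneg_left (Real.log_le_log hs hst) p.cast_nonneg
    linarith

end AssocFun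

/-! ### Gevrey sequences and the power function `t^{1/α}` -/

section Gevrey

theorem gevrey_pos (α : ℝ) (p : ℕ) : 0 < gevrey α p :=
  Real.rpow_pos_of_pos (by exact_mod_cast p.factorial_pos) _

theorem gevrey_zero (α : ℝ) : gevrey α 0 = 1 := by simp [gevrey]

theorem log_gevrey (α : ℝ) (p : ℕ) : Real.log (gevrey α p) = α * Real.log p.factorial :=
  Real.log_rpow (by exact_mod_cast p.factorial_pos) _

theorem log_factorial_le (p : ℕ) : Real.log p.factorial ≤ p * Real.log p := by
  rw [← Real.log_pow]
  refine Real.log_le_log (by exact_mod_cast p.factorial_pos) ?_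
  exact_mod_cast p.factorial_le_pow

theorem mul_log_le_log_factorial_add (p : ℕ) : p * Real.log p ≤ Real.log p.factorial + p := by
  rcases p.eq_zero_or_pos with rfl | hp
  · simp
  have hp' : (0 : ℝ) < p := by exact_mod_cast hp
  have hf : (0 : ℝ) < p.factorial := by exact_mod_cast p.factorial_pos
  have h := Real.pow_div_factorial_le_exp (p : ℝ) hp'.le p
  have h1 := Real.log_le_log (div_pos (pow_pos hp' p) hf) h
  rw [Real.log_div (pow_pos hp' p).ne' hf.ne', Real.log_pow, Real.log_exp] at h1
  linarith

/-- This is `u^p / p! ≤ e^u` for `u = e^{y/α}`, raised to the power `α`. -/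
theorem gevrey_term_le {α : ℝ} (hα : 0 < α) (y : ℝ) (p : ℕ) :
    p * y - Real.log (gevrey α p) ≤ α * Real.exp y ^ (1 / α) := by
  have hf : (0 : ℝ) < p.factorial := by exact_mod_cast p.factorial_pos
  have hu : 0 < Real.exp y ^ (1 / α) := Real.rpow_pos_of_pos (Real.exp_pos y) _
  have h := Real.pow_div_factorial_le_exp _ hu.le p
  have h1 := Real.log_le_log (div_pos (pow_pos hu p) hf) h
  rw [Real.log_div (pow_pos hu p).ne' hf.ne', Real.log_pow, Real.log_exp,
    Real.log_rpow (Real.exp_pos y), Real.log_exp] at h1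
  rw [log_gevrey]
  have h2 := mul_le_mul_of_nonneg_left h1 hα.le
  have h3 : α * (p * (1 / α * y) - Real.log p.factorial) = p * y - α * Real.log p.factorial := by
    field_simp
  linarith

theorem assocFunFinite_gevrey {α : ℝ} (hα : 0 < α) : AssocFunFinite (gevrey α) :=
  assocFunFinite_of_forall (gevrey_pos α) (gevrey_zero α) fun y => ⟨_, gevrey_term_le hα y⟩

theorem assocFun_gevrey_le {α : ℝ} (hα : 0 < α) {t : ℝ} (ht : 0 ≤ t) :
    assocFun (gevrey α) t ≤ α * t ^ (1 / α) := by
  rcases ht.eq_or_lt with rfl | ht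
  · rw [assocFun_zero (gevrey_zero α)]
    positivity
  · rw [← Real.exp_log ht]
    exact assocFun_le (gevrey_pos α) (gevrey_term_le hα _)

/-- Halving `u` gains `2^{-p}` in each term, so the exponential series at `u / 2` is dominated by a
geometric series with sum `2 e^S`. -/
theorem half_le_of_forall_pow_div_factorial_le {u S : ℝ}
    (h : ∀ p : ℕ, u ^ p / p.factorial ≤ Real.exp S) : u / 2 ≤ S + Real.log 2 := by
  have h1 : HasSum (fun n : ℕ => (u / 2) ^ n / (n.factorial : ℝ)) (Real.exp (u / 2)) := by
    rw [Real.exp_eq_exp_ℝ]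
    exact NormedSpace.expSeries_div_hasSum_exp (u / 2)
  have h2 : HasSum (fun n : ℕ => Real.exp S * (1 / 2) ^ n) (Real.exp S * 2) :=
    hasSum_geometric_two.mul_left _
  have h3 : Real.exp (u / 2) ≤ Real.exp S * 2 := by
    refine hasSum_le (fun n => ?_) h1 h2
    have h4 : (u / 2) ^ n / (n.factorial : ℝ) = u ^ n / n.factorial * (1 / 2) ^ n := by
      rw [div_pow, div_pow, one_pow]
      ring
    rw [h4]
    exact mul_le_mul_of_nonneg_right (h n) (by positivity)
  rw [← Real.exp_le_exp, Real.exp_add, Real.exp_log two_pos]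
  exact h3

theorem le_assocFun_gevrey {α : ℝ} (hα : 0 < α) {t : ℝ} (ht : 0 ≤ t) :
    α / 2 * t ^ (1 / α) ≤ assocFun (gevrey α) t + α * Real.log 2 := by
  rcases ht.eq_or_lt with rfl | ht
  · rw [assocFun_zero (gevrey_zero α), Real.zero_rpow (by positivity)]
    have := Real.log_pos one_lt_two
    simp only [mul_zero, zero_add]
    positivity
  · have hu : 0 < t ^ (1 / α) := Real.rpow_pos_of_pos ht _
    have h := half_le_of_forall_pow_div_factorial_le (u := t ^ (1 / α))
      (S := assocFun (gevrey α) t / α) fun p => by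
        have hf : (0 : ℝ) < p.factorial := by exact_mod_cast p.factorial_pos
        rw [← Real.log_le_iff_le_exp (div_pos (pow_pos hu p) hf),
          Real.log_div (pow_pos hu p).ne' hf.ne', Real.log_pow, Real.log_rpow ht,
          le_div_iff₀ hα]
        have h1 := (assocFunFinite_gevrey hα).le_assocFun (gevrey_pos α) (Real.log t) p
        rw [Real.exp_log ht, log_gevrey] at h1
        calc _ = p * Real.log t - α * Real.log p.factorial := by field_simp
          _ ≤ _ := h1
    have h2 := mul_le_mul_of_nonneg_left h hα.le
    have h3 : α * (assocFun (gevrey α) t / α + Real.log 2) =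
        assocFun (gevrey α) t + α * Real.log 2 := by field_simp
    linarith

end Gevrey

/-! ### The sequences `W^(ℓ)` and comparability of `ω_{W^(ℓ)}` with `ω` -/

section AssocMatrix

variable {ω : ℝ → ℝ} (hω : IsBMTWeight ω)

include hω

theorem IsBMTWeight.logWeight_zero {ℓ : ℝ} (hℓ : 0 < ℓ) : logWeight ω ℓ 0 = 0 := by
  refine le_antisymm (logWeight_le hℓ fun y => ?_) ?_
  · have := div_nonneg (hω.nonneg (Real.exp_pos y).le) hℓ.le
    linarith
  · have := hω.dominatesLog.le_logWeight hℓ le_rfl 0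
    rwa [hω.normalized _ (Real.exp_pos 0).le (by simp), zero_mul, zero_div, sub_zero] at this

theorem IsBMTWeight.assocMatrix_zero {ℓ : ℝ} (hℓ : 0 < ℓ) : assocMatrix ω ℓ 0 = 1 := by
  rw [assocMatrix_eq_exp, Nat.cast_zero, hω.logWeight_zero hℓ, Real.exp_zero]

theorem IsBMTWeight.logWeight_nonneg {ℓ x : ℝ} (hℓ : 0 < ℓ) (hx : 0 ≤ x) :
    0 ≤ logWeight ω ℓ x := by
  have := hω.dominatesLog.le_logWeight hℓ hx 0
  rwa [hω.normalized _ (Real.exp_pos 0).le (by simp), mul_zero, zero_div, sub_zero] at this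

theorem IsBMTWeight.assocMatrix_term_le {ℓ : ℝ} (hℓ : 0 < ℓ) (y : ℝ) (p : ℕ) :
    p * y - Real.log (assocMatrix ω ℓ p) ≤ ω (Real.exp y) / ℓ := by
  have := hω.dominatesLog.le_logWeight hℓ p.cast_nonneg y
  rw [log_assocMatrix]
  linarith

theorem IsBMTWeight.assocFunFinite {ℓ : ℝ} (hℓ : 0 < ℓ) : AssocFunFinite (assocMatrix ω ℓ) :=
  assocFunFinite_of_forall (assocMatrix_pos ω ℓ) (hω.assocMatrix_zero hℓ)
    fun y => ⟨_, hω.assocMatrix_term_le hℓ y⟩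

theorem IsBMTWeight.assocFun_le {ℓ : ℝ} (hℓ : 0 < ℓ) {t : ℝ} (ht : 0 ≤ t) :
    assocFun (assocMatrix ω ℓ) t ≤ ω t / ℓ := by
  rcases ht.eq_or_lt with rfl | ht
  · rw [assocFun_zero (hω.assocMatrix_zero hℓ)]
    exact div_nonneg (hω.nonneg le_rfl) hℓ.le
  · rw [← Real.exp_log ht]
    exact WeightedSpaces.assocFun_le (assocMatrix_pos ω ℓ) (hω.assocMatrix_term_le hℓ _)

/-- A supporting line of `φ_ω`. -/
theorem IsBMTWeight.exists_subgradient (y : ℝ) :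
    ∃ x : ℝ, 0 ≤ x ∧ ∀ z, ω (Real.exp y) + x * (z - y) ≤ ω (Real.exp z) := by
  have hy : y ∈ interior (univ : Set ℝ) := by simp
  have hmono : ∀ {a b : ℝ}, a ≤ b → ω (Real.exp a) ≤ ω (Real.exp b) := fun h =>
    hω.mono (Real.exp_pos _).le (Real.exp_pos _).le (Real.exp_le_exp.2 h)
  -- The slope is the right derivative: by convexity it is below the slopes to the right and, being
  -- at least the left derivative, above those to the left.
  have hr : ∀ z, y < z → derivWithin (fun y => ω (Real.exp y)) (Ioi y) y ≤
      (ω (Real.exp z) - ω (Real.exp y)) / (z - y) := fun z hz => by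
    rw [← slope_def_field (fun y => ω (Real.exp y))]
    exact hω.convex.rightDeriv_le_slope_of_mem_interior hy (mem_univ z) hz
  have hl : ∀ z, z < y → (ω (Real.exp y) - ω (Real.exp z)) / (y - z) ≤
      derivWithin (fun y => ω (Real.exp y)) (Ioi y) y := fun z hz => by
    rw [← slope_def_field (fun y => ω (Real.exp y))]
    exact (hω.convex.slope_le_leftDeriv_of_mem_interior (mem_univ z) hy hz).trans
      (hω.convex.leftDeriv_le_rightDeriv_of_mem_interior hy)
  refine ⟨derivWithin (fun y => ω (Real.exp y)) (Ioi y) y, ?_, fun z => ?_⟩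
  · refine le_trans ?_ (hl (y - 1) (by linarith))
    exact div_nonneg (sub_nonneg.2 (hmono (by linarith))) (by linarith)
  · rcases lt_trichotomy z y with h | rfl | h
    · have := hl z h
      rw [div_le_iff₀ (by linarith)] at this
      linarith
    · simp
    · have := hr z h
      rw [le_div_iff₀ (by linarith)] at this
      linarith

/-- If `x` is the slope of a supporting line at `y`, the exponent `x/ℓ` recovers `ω(e^y)/ℓ` exactly.
Rounding it down to an integer loses at most `y`, which the term `p = 1` bounds by `ω_{W^(ℓ)}(e^y) +
log W^(ℓ)_1`; hence the factor `2`. -/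
theorem IsBMTWeight.le_assocFun {ℓ : ℝ} (hℓ : 0 < ℓ) {t : ℝ} (ht : 0 ≤ t) :
    ω t ≤ 2 * ℓ * assocFun (assocMatrix ω ℓ) t + ℓ * logWeight ω ℓ 1 := by
  have hw1 : 0 ≤ logWeight ω ℓ 1 := hω.logWeight_nonneg hℓ zero_le_one
  have hnn := (hω.assocFunFinite hℓ).nonneg (hω.assocMatrix_zero hℓ) ht
  rcases le_or_gt t 1 with h1 | h1
  · rw [hω.normalized t ht h1]
    positivity
  obtain ⟨y, rfl⟩ : ∃ y, t = Real.exp y := ⟨Real.log t, (Real.exp_log (by linarith)).symm⟩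
  have hy : 0 ≤ y := (Real.one_lt_exp_iff.1 h1).le
  obtain ⟨x, hx, hsub⟩ := hω.exists_subgradient y
  have hp := Nat.floor_le (div_nonneg hx hℓ.le)
  have hp' := Nat.lt_floor_add_one (x / ℓ)
  set p := ⌊x / ℓ⌋₊
  -- The supporting line at `0` gives `ω(e^y) ≤ x y`, which settles the case `z ≤ 0` below.
  have hz0 := hsub 0
  rw [hω.normalized (Real.exp 0) (Real.exp_pos 0).le (by simp)] at hz0
  have hw : logWeight ω ℓ p ≤ (x * y - ω (Real.exp y)) / ℓ := by
    refine logWeight_le hℓ fun z => ?_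
    rw [le_div_iff₀ hℓ, sub_mul, div_mul_cancel₀ _ hℓ.ne']
    rcases le_total 0 z with hz | hz
    · have h2 : (p : ℝ) * z * ℓ ≤ x * z := by
        rw [le_div_iff₀ hℓ] at hp
        nlinarith
      linarith [hsub z]
    · have h2 : (p : ℝ) * z * ℓ ≤ 0 :=
        mul_nonpos_of_nonpos_of_nonneg (mul_nonpos_of_nonneg_of_nonpos p.cast_nonneg hz) hℓ.le
      linarith [hω.nonneg (Real.exp_pos z).le]
  have hA := (hω.assocFunFinite hℓ).le_assocFun (assocMatrix_pos ω ℓ) y p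
  have hB := (hω.assocFunFinite hℓ).le_assocFun (assocMatrix_pos ω ℓ) y 1
  rw [log_assocMatrix] at hA hB
  rw [Nat.cast_one, one_mul] at hB
  rw [le_div_iff₀ hℓ] at hw
  rw [div_lt_iff₀ hℓ] at hp'
  have h3 : x * y ≤ (p + 1) * ℓ * y := mul_le_mul_of_nonneg_right hp'.le hy
  have h4 := mul_le_mul_of_nonneg_left hA hℓ.le
  have h5 := mul_le_mul_of_nonneg_left hB hℓ.le
  linarith

omit hω

theorem quotientMatrix_pos (ω : ℝ → ℝ) (α ℓ : ℝ) (p : ℕ) : 0 < quotientMatrix ω α ℓ p :=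
  div_pos (assocMatrix_pos ω ℓ p) (gevrey_pos α p)

theorem log_quotientMatrix (ω : ℝ → ℝ) (α ℓ : ℝ) (p : ℕ) :
    Real.log (quotientMatrix ω α ℓ p) = logWeight ω ℓ p - α * Real.log p.factorial := by
  rw [quotientMatrix, Real.log_div (assocMatrix_pos ω ℓ p).ne' (gevrey_pos α p).ne',
    log_assocMatrix, log_gevrey]

theorem IsBMTWeight.quotientMatrix_zero (hω : IsBMTWeight ω) (α : ℝ) {ℓ : ℝ} (hℓ : 0 < ℓ) :
    quotientMatrix ω α ℓ 0 = 1 := by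
  rw [quotientMatrix, hω.assocMatrix_zero hℓ, gevrey_zero, div_one]

end AssocMatrix

/-! ### The upper conjugate -/

section UpperConj

variable {σ τ σ' τ' : ℝ → ℝ}

theorem UpperConjFinite.le_upperConj (h : UpperConjFinite σ τ) {s t : ℝ} (hs : 0 ≤ s)
    (ht : 0 < t) : σ s - τ (s / t) ≤ upperConj σ τ t := by
  rw [upperConj, if_neg ht.ne']
  exact le_csSup (h t ht) ⟨s, hs, rfl⟩

theorem upperConj_le {t B : ℝ} (ht : 0 < t) (h : ∀ s, 0 ≤ s → σ s - τ (s / t) ≤ B) :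
    upperConj σ τ t ≤ B := by
  rw [upperConj, if_neg ht.ne']
  exact csSup_le (nonempty_Ici.image _) (by rintro _ ⟨s, hs, rfl⟩; exact h s hs)

theorem upperConj_zero (hσ : σ 0 = 0) (hτ : τ 0 = 0) : upperConj σ τ 0 = 0 := by
  simp [upperConj, hσ, hτ]

theorem UpperConjFinite.nonneg (h : UpperConjFinite σ τ) (hσ : σ 0 = 0) (hτ : τ 0 = 0) {t : ℝ}
    (ht : 0 ≤ t) : 0 ≤ upperConj σ τ t := by
  rcases ht.eq_or_lt with rfl | ht
  · rw [upperConj_zero hσ hτ]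
  · simpa [hσ, hτ] using h.le_upperConj le_rfl ht

theorem UpperConjFinite.monotoneOn (h : UpperConjFinite σ τ) (hσ : σ 0 = 0) (hτ : τ 0 = 0)
    (hmono : MonotoneOn τ (Ici 0)) : MonotoneOn (upperConj σ τ) (Ici 0) := by
  intro s hs t ht hst
  rcases (show (0 : ℝ) ≤ s from hs).eq_or_lt with rfl | hs
  · rw [upperConj_zero hσ hτ]
    exact h.nonneg hσ hτ ht
  · have ht : 0 < t := hs.trans_le hst
    refine upperConj_le hs fun r hr => le_trans ?_ (h.le_upperConj hr ht)
    have := hmono (show r / t ∈ Ici 0 from div_nonneg hr ht.le)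
      (show r / s ∈ Ici 0 from div_nonneg hr hs.le) (div_le_div_of_nonneg_left hr hs hst)
    linarith

/-- The defining terms of `σ ⋆̂ τ` are bounded in terms of `σ' ⋆̂ τ'`. -/
theorem UpperConjFinite.term_le (h : UpperConjFinite σ' τ') {A D D' c : ℝ} (hA : 0 ≤ A)
    (hc : 0 < c) (hσ : ∀ s, 0 ≤ s → σ s ≤ A * σ' s + D)
    (hτ : ∀ s, 0 ≤ s → A * τ' (s / c) ≤ τ s + D') {t s : ℝ} (ht : 0 < t) (hs : 0 ≤ s) :
    σ s - τ (s / t) ≤ A * upperConj σ' τ' (c * t) + (D + D') := by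
  have h1 := mul_le_mul_of_nonneg_left (h.le_upperConj hs (mul_pos hc ht)) hA
  have h2 := hτ (s / t) (div_nonneg hs ht.le)
  rw [div_div, mul_comm t c] at h2
  linarith [hσ s hs]

theorem UpperConjFinite.of_le (h : UpperConjFinite σ' τ') {A D D' c : ℝ} (hA : 0 ≤ A)
    (hc : 0 < c) (hσ : ∀ s, 0 ≤ s → σ s ≤ A * σ' s + D)
    (hτ : ∀ s, 0 ≤ s → A * τ' (s / c) ≤ τ s + D') : UpperConjFinite σ τ := by
  intro t ht
  refine ⟨A * upperConj σ' τ' (c * t) + (D + D'), ?_⟩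
  rintro _ ⟨s, hs, rfl⟩
  exact h.term_le hA hc hσ hτ ht hs

theorem UpperConjFinite.upperConj_le (h : UpperConjFinite σ' τ') {A D D' c : ℝ} (hA : 0 ≤ A)
    (hc : 0 < c) (hσ : ∀ s, 0 ≤ s → σ s ≤ A * σ' s + D)
    (hτ : ∀ s, 0 ≤ s → A * τ' (s / c) ≤ τ s + D') {t : ℝ} (ht : 0 < t) :
    upperConj σ τ t ≤ A * upperConj σ' τ' (c * t) + (D + D') :=
  WeightedSpaces.upperConj_le ht fun _ hs => h.term_le hA hc hσ hτ ht hs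

end UpperConj

/-! ### The conjugate with a power function -/

section PowerConj

variable {ω : ℝ → ℝ} {α : ℝ}

theorem monotoneOn_idPow {a : ℝ} (ha : 0 ≤ a) : MonotoneOn (idPow a) (Ici 0) :=
  fun _ hs _ _ hst => Real.rpow_le_rpow hs hst ha

theorem idPow_zero {a : ℝ} (ha : 0 < a) : idPow a 0 = 0 := Real.zero_rpow ha.ne'

/-- Constant factors in front of the power function amount to dilations of its argument. -/
theorem idPow_div_rpow (hα : 0 < α) {s b : ℝ} (hs : 0 ≤ s) (hb : 0 ≤ b) :
    idPow (1 / α) (s / b ^ α) = s ^ (1 / α) / b := by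
  rw [idPow, Real.div_rpow hs (Real.rpow_nonneg hb _), one_div, Real.rpow_rpow_inv hb hα.ne']

theorem IsBMTWeight.upperConjFinite_idPow (hω : IsBMTWeight ω)
    (hgrowth : ω =o[atTop] fun t : ℝ => t ^ (1 / α)) : UpperConjFinite ω (idPow (1 / α)) := by
  intro t ht
  -- With this constant `ω(s) ≤ (s/t)^{1/α}` for `s ≥ T`, so only bounded `s` can contribute a
  -- positive term.
  obtain ⟨T, hT⟩ := eventually_atTop.1 (hgrowth.def (c := (1 / t) ^ (1 / α)) (by positivity))
  refine ⟨ω (max T 0), ?_⟩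
  rintro _ ⟨s, hs, rfl⟩
  have hs : 0 ≤ s := hs
  have h0 : 0 ≤ (s / t) ^ (1 / α) := by positivity
  simp only [idPow]
  rcases le_total T s with h | h
  · have h1 := hT s h
    rw [Real.norm_eq_abs, Real.norm_eq_abs, abs_of_nonneg (hω.nonneg hs),
      abs_of_nonneg (Real.rpow_nonneg hs _), ← Real.mul_rpow (by positivity) hs,
      one_div_mul_eq_div] at h1
    linarith [hω.nonneg (le_max_right T 0)]
  · linarith [hω.mono (show s ∈ Ici 0 from hs) (le_max_right T 0) (h.trans (le_max_left T 0))]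

/-- `ω(k t) ≤ C ω(t) + D` for some `k` and some `C < k^a`. -/
def SlowDilation (ω : ℝ → ℝ) (a : ℝ) : Prop :=
  ∃ k C D : ℝ, 0 < k ∧ 0 < C ∧ C < k ^ a ∧ ∀ t, 0 ≤ t → ω (k * t) ≤ C * ω t + D

/-- `σ(R t) = O(σ(t)) + O(1)` for all `R > 0`. -/
def StableUnderDilation (σ : ℝ → ℝ) : Prop := ∀ R, 0 < R → LeUpToConst (fun t => σ (R * t)) σ

theorem IsBMTWeight.monotoneOn_upperConj_idPow (hω : IsBMTWeight ω) (hα : 0 < α)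
    (hfin : UpperConjFinite ω (idPow (1 / α))) : MonotoneOn (upperConj ω (idPow (1 / α))) (Ici 0) :=
  hfin.monotoneOn (hω.normalized 0 le_rfl zero_le_one) (idPow_zero (by positivity))
    (monotoneOn_idPow (by positivity))

/-- Inserting `ω(s) ≤ C ω(s/k) + D` into the supremum for `v(kt)` and factoring out `C` gives `v(kt)
≤ C v(C^α t) + D`. Since `C^α < k`, this bounds a dilation by some `r > 1`; powers of `r` and
monotonicity give all the others. -/
theorem IsBMTWeight.stableUnderDilation (hω : IsBMTWeight ω) (hα : 0 < α)
    (hfin : UpperConjFinite ω (idPow (1 / α))) (hslow : SlowDilation ω (1 / α)) :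
    StableUnderDilation (upperConj ω (idPow (1 / α))) := by
  obtain ⟨k, C, D, hk, hC, hCk, h⟩ := hslow
  set v := upperConj ω (idPow (1 / α)) with hv
  have hCα : 0 < C ^ α := Real.rpow_pos_of_pos hC α
  have h1 : ∀ t, 0 < t → v (k * t) ≤ C * v (C ^ α * t) + D := fun t ht => by
    refine upperConj_le (mul_pos hk ht) fun s hs => ?_
    have h2 := hfin.le_upperConj (div_nonneg hs hk.le) (mul_pos hCα ht)
    have h3 : s / k / (C ^ α * t) = s / (k * t) / C ^ α := by field_simp
    rw [h3, idPow_div_rpow hα (div_nonneg hs (mul_pos hk ht).le) hC.le] at h2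
    have h4 := h (s / k) (div_nonneg hs hk.le)
    rw [mul_div_cancel₀ s hk.ne'] at h4
    have h5 := mul_le_mul_of_nonneg_left h2 hC.le
    rw [mul_sub, mul_div_cancel₀ _ hC.ne'] at h5
    simp only [idPow]
    linarith
  have hr : 1 < k / C ^ α := by
    rw [one_lt_div hCα]
    calc C ^ α < (k ^ (1 / α)) ^ α := Real.rpow_lt_rpow hC.le hCk hα
      _ = k := by rw [one_div, Real.rpow_inv_rpow hk.le hα.ne']
  set r := k / C ^ α with hr_def
  have h2 : LeUpToConst (fun t => v (r * t)) v := ⟨C, D, hC, fun t ht => by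
    have := h1 (t / C ^ α) (by positivity)
    rw [mul_div_cancel₀ _ hCα.ne'] at this
    convert this using 2
    rw [hr_def]
    ring⟩
  have h3 : ∀ n : ℕ, LeUpToConst (fun t => v (r ^ n * t)) v := fun n => by
    induction n with
    | zero => exact ⟨1, 0, one_pos, fun t _ => by simp⟩
    | succ n ih =>
      obtain ⟨C₁, D₁, hC₁, h₁⟩ := ih
      obtain ⟨C₂, D₂, hC₂, h₂⟩ := h2
      refine ⟨C₁ * C₂, C₁ * D₂ + D₁, by positivity, fun t ht => ?_⟩
      have e1 := h₁ (r * t) (by positivity)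
      have e2 := mul_le_mul_of_nonneg_left (h₂ t ht) hC₁.le
      have e3 : r ^ (n + 1) * t = r ^ n * (r * t) := by ring
      simp only [e3] at e1 e2 ⊢
      linarith
  intro R hR
  obtain ⟨n, hn⟩ := pow_unbounded_of_one_lt R hr
  obtain ⟨C', D', hC', h'⟩ := h3 n
  refine ⟨C', D', hC', fun t ht => le_trans ?_ (h' t ht)⟩
  exact hω.monotoneOn_upperConj_idPow hα hfin (show R * t ∈ Ici 0 from by
    simp only [mem_Ici]; positivity) (show r ^ n * t ∈ Ici 0 from by
    simp only [mem_Ici]; positivity) (mul_le_mul_of_nonneg_right hn.le ht.le)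

theorem UpperConjFinite.of_power {σ τ : ℝ → ℝ} (hα : 0 < α)
    (hfin : UpperConjFinite ω (idPow (1 / α))) {A D b E : ℝ} (hA : 0 < A) (hb : 0 < b)
    (hσ : ∀ s, 0 ≤ s → σ s ≤ A * ω s + D)
    (hτ : ∀ s, 0 ≤ s → b * s ^ (1 / α) ≤ τ s + E) :
    UpperConjFinite σ τ ∧ ∀ t, 0 < t →
      upperConj σ τ t ≤ A * upperConj ω (idPow (1 / α)) ((A / b) ^ α * t) + (D + E) := by
  have h : ∀ s, 0 ≤ s → A * idPow (1 / α) (s / (A / b) ^ α) ≤ τ s + E := fun s hs => by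
    rw [idPow_div_rpow hα hs (by positivity)]
    calc _ = b * s ^ (1 / α) := by field_simp
      _ ≤ _ := hτ s hs
  exact ⟨hfin.of_le hA.le (by positivity) hσ h,
    fun t ht => hfin.upperConj_le hA.le (by positivity) hσ h ht⟩

theorem UpperConjFinite.leUpToConst_power {σ τ : ℝ → ℝ} (hα : 0 < α)
    (hfin : UpperConjFinite ω (idPow (1 / α)))
    (hstab : StableUnderDilation (upperConj ω (idPow (1 / α)))) {A D b E : ℝ} (hA : 0 < A)
    (hb : 0 < b) (hσ : ∀ s, 0 ≤ s → σ s ≤ A * ω s + D)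
    (hτ : ∀ s, 0 ≤ s → b * s ^ (1 / α) ≤ τ s + E) :
    LeUpToConst (upperConj σ τ) (upperConj ω (idPow (1 / α))) := by
  refine LeUpToConst.trans ⟨A, D + E, hA, (hfin.of_power hα hA hb hσ hτ).2⟩
    (hstab ((A / b) ^ α) (by positivity))

theorem UpperConjFinite.power_leUpToConst {σ τ : ℝ → ℝ} (hα : 0 < α) (hfin : UpperConjFinite σ τ)
    (hstab : StableUnderDilation (upperConj ω (idPow (1 / α)))) {A D B : ℝ} (hA : 0 < A)
    (hB : 0 < B) (hσ : ∀ s, 0 ≤ s → ω s ≤ A * σ s + D)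
    (hτ : ∀ s, 0 ≤ s → τ s ≤ B * s ^ (1 / α)) :
    LeUpToConst (upperConj ω (idPow (1 / α))) (upperConj σ τ) := by
  set c := (A * B) ^ α with hc_def
  have hc : 0 < c := by positivity
  have h : ∀ s, 0 ≤ s → A * τ (s / c) ≤ idPow (1 / α) s + 0 := fun s hs => by
    have h1 := mul_le_mul_of_nonneg_left (hτ (s / c) (by positivity)) hA.le
    have h2 : (s / c) ^ (1 / α) = s ^ (1 / α) / (A * B) := idPow_div_rpow hα hs (by positivity)
    rw [h2] at h1
    calc _ ≤ _ := h1
      _ = idPow (1 / α) s + 0 := by rw [idPow]; field_simp; simp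
  have h1 : LeUpToConst (fun t => upperConj ω (idPow (1 / α)) (c⁻¹ * t)) (upperConj σ τ) :=
    ⟨A, D + 0, hA, fun t ht => by
      have := hfin.upperConj_le hA.le hc hσ h (t := c⁻¹ * t) (by positivity)
      rwa [mul_inv_cancel_left₀ hc.ne'] at this⟩
  refine LeUpToConst.trans ?_ h1
  -- Stability, applied at `c⁻¹ t`, undoes the dilation in `h1`.
  obtain ⟨C', D', hC', h'⟩ := hstab c hc
  refine ⟨C', D', hC', fun t ht => ?_⟩
  have := h' (c⁻¹ * t) (by positivity)
  simpa only [mul_inv_cancel_left₀ hc.ne'] using this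

/-- This is the term `s = t` of the supremum. -/
theorem UpperConjFinite.sub_one_le (hfin : UpperConjFinite ω (idPow (1 / α))) {t : ℝ}
    (ht : 0 < t) : ω t - 1 ≤ upperConj ω (idPow (1 / α)) t := by
  have := hfin.le_upperConj ht.le ht
  rwa [div_self ht.ne', idPow, Real.one_rpow] at this

/-- `(((ω^α)^⋆)^ι)^{1/α} = ω ⋆̂ id^{1/α}`. -/
theorem powSubst_inversion_upperLegendre (hω0 : ω 0 = 0) (hα : 0 < α) {t : ℝ} (ht : 0 ≤ t) :
    powSubst (inversion (upperLegendre (powSubst ω α))) (1 / α) t =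
      upperConj ω (idPow (1 / α)) t := by
  rcases ht.eq_or_lt with rfl | ht
  -- At `t = 0` both sides are `0`, the left one by the convention in `inversion`.
  · rw [upperConj_zero hω0 (idPow_zero (by positivity)), powSubst,
      Real.zero_rpow (by positivity), inversion, if_pos rfl]
  · have ht' : 0 < t ^ (1 / α) := Real.rpow_pos_of_pos ht _
    rw [powSubst, inversion, if_neg ht'.ne', upperConj, if_neg ht.ne', upperLegendre]
    -- The two sets of terms correspond under `s ↦ s^α` and its inverse.
    congr 1
    ext x
    simp only [mem_image, mem_Ici, powSubst, idPow]
    constructor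
    · rintro ⟨s, hs, rfl⟩
      refine ⟨s ^ α, Real.rpow_nonneg hs _, ?_⟩
      rw [Real.div_rpow (Real.rpow_nonneg hs _) ht.le, one_div α, Real.rpow_rpow_inv hs hα.ne']
      ring
    · rintro ⟨s, hs, rfl⟩
      refine ⟨s ^ (1 / α), Real.rpow_nonneg hs _, ?_⟩
      rw [Real.div_rpow hs ht.le, one_div α, Real.rpow_inv_rpow hs hα.ne']
      ring

theorem UpperConjFinite.upperLegendreFinite (hα : 0 < α)
    (hfin : UpperConjFinite ω (idPow (1 / α))) : UpperLegendreFinite (powSubst ω α) := by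
  intro t ht
  have ht' : 0 < (1 / t) ^ α := by positivity
  refine ⟨upperConj ω (idPow (1 / α)) ((1 / t) ^ α), ?_⟩
  rintro _ ⟨s, hs, rfl⟩
  have hs : 0 ≤ s := hs
  have h := hfin.le_upperConj (Real.rpow_nonneg hs α) ht'
  rw [idPow_div_rpow hα (Real.rpow_nonneg hs _) (by positivity), one_div α,
    Real.rpow_rpow_inv hs hα.ne'] at h
  simp only [powSubst]
  calc _ = ω (s ^ α) - s / (1 / t) := by field_simp
    _ ≤ _ := by rw [one_div α]; exact h

end PowerConj

/-! ### Quotients by Gevrey sequences -/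

section Quotient

variable {ω : ℝ → ℝ} {α : ℝ}

theorem upperConjFinite_assocFun (hω : IsBMTWeight ω) (hα : 0 < α)
    (hfin : UpperConjFinite ω (idPow (1 / α))) {ℓ : ℝ} (hℓ : 0 < ℓ) :
    UpperConjFinite (assocFun (assocMatrix ω ℓ)) (assocFun (gevrey α)) :=
  (hfin.of_power hα (A := 1 / ℓ) (D := 0) (b := α / 2) (by positivity) (by positivity)
    (fun s hs => by rw [one_div_mul_eq_div, add_zero]; exact hω.assocFun_le hℓ hs)
    fun s hs => le_assocFun_gevrey hα hs).1

/-- The conjugate is tested at `s = e^y p^α`, where `ω_{G^α}(p^α) ≤ α p`; then `p! ≤ p^p` suffices.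
The loss `α p` becomes a dilation by `e^α` in `assocFun_quotientMatrix_le`. -/
theorem quotientMatrix_term_le (hω : IsBMTWeight ω) (hα : 0 < α)
    (hfin : UpperConjFinite ω (idPow (1 / α))) {ℓ : ℝ} (hℓ : 0 < ℓ) (y : ℝ) (p : ℕ) :
    p * y - Real.log (quotientMatrix ω α ℓ p) ≤
      upperConj (assocFun (assocMatrix ω ℓ)) (assocFun (gevrey α)) (Real.exp y) + α * p := by
  have hfin' := upperConjFinite_assocFun hω hα hfin hℓ
  rcases p.eq_zero_or_pos with rfl | hp
  · rw [hω.quotientMatrix_zero α hℓ]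
    simpa using hfin'.nonneg (assocFun_zero (hω.assocMatrix_zero hℓ))
      (assocFun_zero (gevrey_zero α)) (Real.exp_pos y).le
  have hp' : (0 : ℝ) < p := by exact_mod_cast hp
  have h1 := hfin'.le_upperConj (Real.exp_pos (y + α * Real.log p)).le (Real.exp_pos y)
  have h2 : Real.exp (y + α * Real.log p) / Real.exp y = (p : ℝ) ^ α := by
    rw [Real.exp_add, mul_div_cancel_left₀ _ (Real.exp_pos y).ne', mul_comm α,
      Real.exp_mul, Real.exp_log hp']
  have h3 := assocFun_gevrey_le hα (Real.rpow_nonneg hp'.le α)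
  rw [one_div, Real.rpow_rpow_inv hp'.le hα.ne'] at h3
  have h4 := (hω.assocFunFinite hℓ).le_assocFun (assocMatrix_pos ω ℓ) (y + α * Real.log p) p
  rw [h2] at h1
  rw [log_assocMatrix] at h4
  rw [log_quotientMatrix]
  have h5 := mul_le_mul_of_nonneg_left (log_factorial_le p) hα.le
  linarith

theorem assocFunFinite_quotientMatrix (hω : IsBMTWeight ω) (hα : 0 < α)
    (hfin : UpperConjFinite ω (idPow (1 / α))) {ℓ : ℝ} (hℓ : 0 < ℓ) :
    AssocFunFinite (quotientMatrix ω α ℓ) :=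
  assocFunFinite_of_forall (quotientMatrix_pos ω α ℓ) (hω.quotientMatrix_zero α hℓ) fun y =>
    ⟨_, fun p => by
      have := quotientMatrix_term_le hω hα hfin hℓ (y + α) p
      have h : p * (y + α) - Real.log (quotientMatrix ω α ℓ p) - α * p =
        p * y - Real.log (quotientMatrix ω α ℓ p) := by ring
      rw [← h, sub_le_iff_le_add]
      exact this⟩

theorem assocFun_quotientMatrix_le (hω : IsBMTWeight ω) (hα : 0 < α)
    (hfin : UpperConjFinite ω (idPow (1 / α))) {ℓ : ℝ} (hℓ : 0 < ℓ) {t : ℝ} (ht : 0 < t) :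
    assocFun (quotientMatrix ω α ℓ) t ≤
      upperConj (assocFun (assocMatrix ω ℓ)) (assocFun (gevrey α)) (Real.exp α * t) := by
  rw [← Real.exp_log ht, ← Real.exp_add]
  refine assocFun_le (quotientMatrix_pos ω α ℓ) fun p => ?_
  have := quotientMatrix_term_le hω hα hfin hℓ (α + Real.log t) p
  linarith

/-- No loss occurs here: `s^p / W_p` is the product of `t^p p!^α / W_p` and `(s/t)^p / p!^α`. -/
theorem upperConj_le_assocFun_quotientMatrix (hω : IsBMTWeight ω) (hα : 0 < α)
    (hfin : UpperConjFinite ω (idPow (1 / α))) {ℓ : ℝ} (hℓ : 0 < ℓ) {t : ℝ} (ht : 0 < t) :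
    upperConj (assocFun (assocMatrix ω ℓ)) (assocFun (gevrey α)) t ≤
      assocFun (quotientMatrix ω α ℓ) t := by
  have hq := assocFunFinite_quotientMatrix hω hα hfin hℓ
  refine upperConj_le ht fun s hs => ?_
  rcases hs.eq_or_lt with rfl | hs
  · rw [zero_div, assocFun_zero (hω.assocMatrix_zero hℓ), assocFun_zero (gevrey_zero α), sub_zero]
    exact hq.nonneg (hω.quotientMatrix_zero α hℓ) ht.le
  · rw [sub_le_iff_le_add]
    nth_rw 1 [← Real.exp_log hs]
    refine assocFun_le (assocMatrix_pos ω ℓ) fun p => ?_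
    have h1 := hq.le_assocFun (quotientMatrix_pos ω α ℓ) (Real.log t) p
    have h2 := (assocFunFinite_gevrey hα).le_assocFun (gevrey_pos α) (Real.log (s / t)) p
    rw [Real.exp_log ht, log_quotientMatrix] at h1
    rw [Real.exp_log (div_pos hs ht), log_gevrey, Real.log_div hs.ne' ht.ne'] at h2
    rw [log_assocMatrix]
    linarith

end Quotient

/-! ### Consequences of the growth index -/

section GrowthIndex

theorem exists_thilliezProperty {M : ℕ → ℝ} {α : ℝ}
    (h : ENNReal.ofReal α < thilliezIndex M) : ∃ γ, α < γ ∧ 0 < γ ∧ ThilliezProperty M γ := by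
  obtain ⟨γ, h⟩ := lt_iSup_iff.1 h
  obtain ⟨⟨hγ, hM⟩, h⟩ := lt_iSup_iff.1 h
  exact ⟨γ, (ENNReal.ofReal_lt_ofReal_iff hγ).1 h, hγ, hM⟩

theorem quot_pos {M : ℕ → ℝ} (hM : ∀ p, 0 < M p) (p : ℕ) : 0 < quot M p := by
  cases p with
  | zero => exact one_pos
  | succ p => exact div_pos (hM _) (hM _)

theorem log_quot_succ {M : ℕ → ℝ} (hM : ∀ p, 0 < M p) (p : ℕ) :
    Real.log (quot M (p + 1)) = Real.log (M (p + 1)) - Real.log (M p) :=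
  Real.log_div (hM _).ne' (hM _).ne'

theorem div_rpow_mono_of_succ {ν : ℕ → ℝ} {γ : ℝ}
    (h : ∀ p : ℕ, 1 ≤ p → ν p / (p : ℝ) ^ γ ≤ ν (p + 1) / ((p + 1 : ℕ) : ℝ) ^ γ) {i j : ℕ}
    (hi : 1 ≤ i) (hij : i ≤ j) : ν i / (i : ℝ) ^ γ ≤ ν j / (j : ℝ) ^ γ := by
  induction j, hij using Nat.le_induction with
  | base => exact le_rfl
  | succ j hj ih => exact ih.trans (h j (hi.trans hj))

/-- Monotonicity of `ν_p / p^γ` yields `ν_j ≥ m^γ ν_i` for `j ≥ m i`; passing between `μ` and `ν`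
twice costs `a²`. -/
theorem ThilliezProperty.exists_quot_le {M : ℕ → ℝ} {γ : ℝ} (hM : ∀ p, 0 < M p) (hγ : 0 ≤ γ)
    (h : ThilliezProperty M γ) : ∃ a : ℝ, 1 ≤ a ∧ ∀ m i j : ℕ, 1 ≤ m → 1 ≤ i → m * i ≤ j →
      quot M i * (m : ℝ) ^ γ ≤ a ^ 2 * quot M j := by
  obtain ⟨ν, a, ha, hν, hmono⟩ := h
  refine ⟨a, ha, fun m i j hm hi hij => ?_⟩
  have ha0 : 0 < a := by linarith
  have hij' : i ≤ j := (Nat.le_mul_of_pos_left i hm).trans hij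
  have hi0 : (0 : ℝ) < i := by exact_mod_cast hi
  have hj0 : (0 : ℝ) < j := by exact_mod_cast hi.trans hij'
  have hiγ : 0 < (i : ℝ) ^ γ := Real.rpow_pos_of_pos hi0 γ
  have h1 := div_rpow_mono_of_succ hmono hi hij'
  rw [div_le_div_iff₀ hiγ (Real.rpow_pos_of_pos hj0 γ)] at h1
  have hνi : 0 < ν i :=
    (mul_pos (inv_pos.2 ha0) (quot_pos hM i)).trans_le (hν i hi).1
  have h2 : (m : ℝ) ^ γ * (i : ℝ) ^ γ ≤ (j : ℝ) ^ γ := by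
    rw [← Real.mul_rpow m.cast_nonneg hi0.le]
    exact Real.rpow_le_rpow (by positivity) (by exact_mod_cast hij) hγ
  have h3 : ν i * (m : ℝ) ^ γ ≤ ν j := by
    have := (mul_le_mul_of_nonneg_left h2 hνi.le).trans h1
    rw [← mul_assoc] at this
    exact le_of_mul_le_mul_right this hiγ
  have h4 : quot M i ≤ a * ν i := by
    have := (hν i hi).1
    rwa [inv_mul_le_iff₀ ha0] at this
  calc quot M i * (m : ℝ) ^ γ ≤ a * ν i * (m : ℝ) ^ γ :=
        mul_le_mul_of_nonneg_right h4 (by positivity)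
    _ = a * (ν i * (m : ℝ) ^ γ) := by ring
    _ ≤ a * (a * quot M j) :=
        mul_le_mul_of_nonneg_left (h3.trans (hν j (hi.trans hij')).2) ha0.le
    _ = a ^ 2 * quot M j := by ring

/-- If the increments of `w` at `j ≥ m i` exceed those at `i` by `κ`, then
`sup_p (p (y + κ) - w p)` is at most about `m sup_q (q y - w q)`. -/
theorem mul_add_sub_le_sum {w : ℕ → ℝ} {y κ : ℝ} {m : ℕ} (h0 : w 0 = 0)
    (h : ∀ i j : ℕ, (m + 1) * (i + 1) ≤ j + 1 → w (i + 1) - w i + κ ≤ w (j + 1) - w j) (n : ℕ) :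
    ((n + m : ℕ) : ℝ) * (y + κ) - w (n + m) ≤
      ∑ j ∈ Finset.range (m + 1), (((n + j) / (m + 1) : ℕ) * y - w ((n + j) / (m + 1))) +
        (m * (y + κ) - w m) := by
  induction n with
  | zero =>
    have : ∀ j ∈ Finset.range (m + 1),
        (((0 + j) / (m + 1) : ℕ) * y - w ((0 + j) / (m + 1))) = 0 := fun j hj => by
      rw [zero_add, Nat.div_eq_of_lt (Finset.mem_range.1 hj), h0]
      simp
    rw [Finset.sum_eq_zero this]
    simp
  | succ n ih =>
    set f : ℕ → ℝ := fun q => (q : ℝ) * y - w q with hf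
    -- Moving the window of `m + 1` consecutive integers by one changes a single quotient: `n / (m +
    -- 1)` leaves and `n / (m + 1) + 1` enters.
    have e1 : ∑ j ∈ Finset.range (m + 1), f ((n + 1 + j) / (m + 1)) =
        ∑ j ∈ Finset.range (m + 1), f ((n + j) / (m + 1)) +
          (f (n / (m + 1) + 1) - f (n / (m + 1))) := by
      have s1 := Finset.sum_range_succ (fun j => f ((n + j) / (m + 1))) (m + 1)
      have s2 := Finset.sum_range_succ' (fun j => f ((n + j) / (m + 1))) (m + 1)
      have s3 : (n + (m + 1)) / (m + 1) = n / (m + 1) + 1 := Nat.add_div_right n m.succ_pos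
      simp only [s3] at s1
      rw [s1] at s2
      have s4 : ∀ j, n + 1 + j = n + (j + 1) := fun j => by ring
      simp only [s4]
      simp only [add_zero] at s2
      linarith
    have e2 := h (n / (m + 1)) (n + m) (by
      have := Nat.div_mul_le_self n (m + 1)
      rw [mul_comm] at this
      linarith)
    have e3 : n + 1 + m = n + m + 1 := by ring
    change _ ≤ ∑ j ∈ Finset.range (m + 1), f ((n + 1 + j) / (m + 1)) + _
    rw [e1, e3]
    have e4 : f (n / (m + 1) + 1) - f (n / (m + 1)) =
        y - (w (n / (m + 1) + 1) - w (n / (m + 1))) := by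
      simp only [hf]
      push_cast
      ring
    rw [e4]
    push_cast at ih ⊢
    linarith

/-- The averaged sum contributes `(m + 1) F`. The remaining exponents up to `m` are handled by `y ≤
F + w 1`, which is the bound `hF` at `q = 1`. -/
theorem mul_add_sub_le {w : ℕ → ℝ} {y κ F : ℝ} {m : ℕ} (h0 : w 0 = 0) (hw : ∀ p, 0 ≤ w p)
    (hκ : 0 ≤ κ)
    (h : ∀ i j : ℕ, (m + 1) * (i + 1) ≤ j + 1 → w (i + 1) - w i + κ ≤ w (j + 1) - w j)
    (hF : ∀ q : ℕ, q * y - w q ≤ F) (p : ℕ) :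
    p * (y + κ) - w p ≤ 2 * (m + 1) * F + m * (w 1 + κ) := by
  have hF0 : 0 ≤ F := by simpa [h0] using hF 0
  have hF1 : y ≤ F + w 1 := by
    have := hF 1
    rw [Nat.cast_one, one_mul] at this
    linarith
  have hm : ∀ q : ℕ, q ≤ m → q * (y + κ) - w q ≤ m * (F + (w 1 + κ)) := fun q hq => by
    have hq' : (q : ℝ) ≤ m := by exact_mod_cast hq
    have h1 : (q : ℝ) * (y + κ) ≤ q * (F + (w 1 + κ)) :=
      mul_le_mul_of_nonneg_left (by linarith) q.cast_nonneg
    have h2 : (q : ℝ) * (F + (w 1 + κ)) ≤ m * (F + (w 1 + κ)) :=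
      mul_le_mul_of_nonneg_right hq' (by linarith [hw 1])
    linarith [hw q]
  rcases le_total p m with hp | hp
  · have := hm p hp
    nlinarith [mul_nonneg (Nat.cast_nonneg (α := ℝ) m) hF0]
  · obtain ⟨n, rfl⟩ := Nat.exists_eq_add_of_le' hp
    have h1 := mul_add_sub_le_sum (y := y) h0 h n
    have h2 : ∑ j ∈ Finset.range (m + 1),
        (((n + j) / (m + 1) : ℕ) * y - w ((n + j) / (m + 1))) ≤ (m + 1) * F := by
      refine (Finset.sum_le_card_nsmul _ _ F fun j _ => hF _).trans_eq ?_
      rw [Finset.card_range, nsmul_eq_mul]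
      push_cast
      ring
    have h3 := hm m le_rfl
    nlinarith [mul_nonneg (Nat.cast_nonneg (α := ℝ) m) hF0]

theorem exists_nat_mul_lt_rpow {a c θ : ℝ} (hθ : 1 < θ) (hc : 0 < c) :
    ∃ m : ℕ, a * (m + 1) < c * ((m + 1 : ℕ) : ℝ) ^ θ := by
  have h : Tendsto (fun m : ℕ => c * ((m + 1 : ℕ) : ℝ) ^ (θ - 1)) atTop atTop :=
    (((tendsto_rpow_atTop (sub_pos.2 hθ)).comp tendsto_natCast_atTop_atTop).comp
      (tendsto_add_atTop_nat 1)).const_mul_atTop hc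
  obtain ⟨m, hm⟩ := (h.eventually_gt_atTop a).exists
  refine ⟨m, ?_⟩
  have hm0 : (0 : ℝ) < ((m + 1 : ℕ) : ℝ) := by positivity
  have h1 := mul_lt_mul_of_pos_right hm hm0
  rw [mul_assoc, ← Real.rpow_add_one hm0.ne', sub_add_cancel] at h1
  push_cast at h1 ⊢
  exact h1

/-- For `j ≥ N i` the quotients grow by at least `k = a⁻² N^γ`, so `ω_{W^(ℓ)}(kt)` is at most `2N
ω_{W^(ℓ)}(t)` plus a constant. Since `k^{1/α}` is of order `N^{γ/α}` with `γ/α > 1`, it exceeds any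
multiple of `N` for large `N`. -/
theorem IsBMTWeight.slowDilation {ω : ℝ → ℝ} (hω : IsBMTWeight ω) {α γ ℓ : ℝ} (hα : 0 < α)
    (hγ : α < γ) (hℓ : 0 < ℓ) (hT : ThilliezProperty (assocMatrix ω ℓ) γ) :
    SlowDilation ω (1 / α) := by
  have hM := assocMatrix_pos ω ℓ
  obtain ⟨a, ha, hq⟩ := hT.exists_quot_le hM (hα.trans hγ).le
  have ha0 : 0 < a := by linarith
  -- The `4` is the `2` of `mul_add_sub_le` times the `2` of `IsBMTWeight.le_assocFun`.
  obtain ⟨m, hm⟩ := exists_nat_mul_lt_rpow (a := 4) (θ := γ / α) (c := (a ^ 2) ⁻¹ ^ (1 / α))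
    ((one_lt_div hα).2 hγ) (by positivity)
  set N : ℝ := ((m + 1 : ℕ) : ℝ) with hN
  have hN0 : 0 < N := by positivity
  set k : ℝ := (a ^ 2)⁻¹ * N ^ γ with hk_def
  have hk0 : 0 < k := by positivity
  have hkα : 4 * N < k ^ (1 / α) := by
    rw [hk_def, Real.mul_rpow (by positivity) (by positivity), ← Real.rpow_mul hN0.le,
      mul_one_div]
    rwa [← Nat.cast_succ] at hm
  have hk1 : 1 ≤ k := by
    by_contra! hlt
    have h1 : k ^ (1 / α) ≤ 1 := Real.rpow_le_one hk0.le hlt.le (by positivity)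
    have h2 : (1 : ℝ) ≤ N := by
      rw [hN]
      push_cast
      linarith [m.cast_nonneg (α := ℝ)]
    linarith
  have hκ : 0 ≤ Real.log k := Real.log_nonneg hk1
  set w : ℕ → ℝ := fun p => Real.log (assocMatrix ω ℓ p) with hw_def
  have hinc : ∀ i j : ℕ, (m + 1) * (i + 1) ≤ j + 1 →
      w (i + 1) - w i + Real.log k ≤ w (j + 1) - w j := fun i j hij => by
    have h1 := hq (m + 1) (i + 1) (j + 1) (by omega) (by omega) hij
    have h2 : quot (assocMatrix ω ℓ) (i + 1) * k ≤ quot (assocMatrix ω ℓ) (j + 1) := by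
      rw [hk_def, mul_left_comm, inv_mul_le_iff₀ (by positivity)]
      exact h1
    have h3 := Real.log_le_log (mul_pos (quot_pos hM _) hk0) h2
    rw [Real.log_mul (quot_pos hM _).ne' hk0.ne', log_quot_succ hM, log_quot_succ hM] at h3
    exact h3
  have hw : ∀ p, 0 ≤ w p := fun p => by
    simp only [hw_def, log_assocMatrix]
    exact hω.logWeight_nonneg hℓ p.cast_nonneg
  have hw0 : w 0 = 0 := by simp [hw_def, hω.assocMatrix_zero hℓ]
  have hfin := hω.assocFunFinite hℓ
  refine ⟨k, 4 * N, 2 * ℓ * (m * (w 1 + Real.log k)) + ℓ * logWeight ω ℓ 1, hk0, by positivity,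
    hkα, fun t ht => ?_⟩
  rcases ht.eq_or_lt with rfl | ht
  · rw [mul_zero, hω.normalized 0 le_rfl zero_le_one]
    have := hω.logWeight_nonneg hℓ zero_le_one
    have := hw 1
    positivity
  have hstep : assocFun (assocMatrix ω ℓ) (k * t) ≤
      2 * N * assocFun (assocMatrix ω ℓ) t + m * (w 1 + Real.log k) := by
    nth_rw 1 [← Real.exp_log ht, ← Real.exp_log hk0, ← Real.exp_add, add_comm]
    refine WeightedSpaces.assocFun_le hM fun p => ?_
    have := mul_add_sub_le (y := Real.log t) (F := assocFun (assocMatrix ω ℓ) t) hw0 hw hκ hinc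
      (fun q => by
        have := hfin.le_assocFun hM (Real.log t) q
        rwa [Real.exp_log ht] at this) p
    rw [hN]
    push_cast
    exact this
  have h1 := hω.le_assocFun hℓ (mul_pos hk0 ht).le
  have h2 := hω.assocFun_le hℓ ht.le
  rw [le_div_iff₀ hℓ] at h2
  have h3 := mul_le_mul_of_nonneg_left hstep (show 0 ≤ 2 * ℓ by positivity)
  have h4 := mul_le_mul_of_nonneg_left h2 (show 0 ≤ 4 * N by positivity)
  linarith

end GrowthIndex

/-! ### The matrix of quotients and the weight functions -/

section MatrixScale

variable {ω : ℝ → ℝ} {α : ℝ}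

/-- A geometric factor `e^{Hx}` is absorbed into the index. The factor `A` depends on `H` but not on
`ℓ`, so the new index can still be prescribed. -/
theorem StableUnderDilation.exists_logWeight_le {v : ℝ → ℝ} (hv : DominatesLog v)
    (hstab : StableUnderDilation v) (H : ℝ) : ∃ A : ℝ, 0 < A ∧ ∀ ℓ, 0 < ℓ → ∃ D : ℝ, ∀ x, 0 ≤ x →
      x * H + logWeight v ℓ x ≤ D + logWeight v (A * ℓ) x := by
  obtain ⟨A, D, hA, h⟩ := hstab (Real.exp H) (Real.exp_pos H)
  refine ⟨A, hA, fun ℓ hℓ => ⟨D / (A * ℓ), fun x hx => ?_⟩⟩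
  have := hv.logWeight_le_of_le (τ := v) hA (Real.exp_pos H) (fun t ht => by
    have := h (t / Real.exp H) (div_pos ht (Real.exp_pos H))
    simp only [mul_div_cancel₀ _ (Real.exp_pos H).ne'] at this
    exact this) hℓ hx
  rwa [Real.log_exp] at this

/-- For each `y` the supremum in `v(e^y)` is tested at `s = e^y (ℓp)^α`, where the subtracted power
equals `ℓ p`; the shift `α log(ℓp)` of `y` produces the division by `p!^α` up to a geometric factor.
-/
theorem logWeight_upperConj_le (hω : IsBMTWeight ω) (hα : 0 < α)
    (hfin : UpperConjFinite ω (idPow (1 / α))) {ℓ : ℝ} (hℓ : 0 < ℓ) (p : ℕ) :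
    logWeight (upperConj ω (idPow (1 / α))) ℓ p ≤
      Real.log (quotientMatrix ω α ℓ p) + p * (1 - α * Real.log ℓ) := by
  refine logWeight_le hℓ fun y => ?_
  rw [log_quotientMatrix]
  rcases p.eq_zero_or_pos with rfl | hp
  · have := div_nonneg (hfin.nonneg (hω.normalized 0 le_rfl zero_le_one)
      (idPow_zero (by positivity)) (Real.exp_pos y).le) hℓ.le
    simpa [hω.logWeight_zero hℓ] using this
  have hp' : (0 : ℝ) < p := by exact_mod_cast hp
  have hx : 0 < ℓ * p := by positivity
  set z := y + α * Real.log (ℓ * p) with hz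
  have h1 := hfin.le_upperConj (Real.exp_pos z).le (Real.exp_pos y)
  have h2 : Real.exp z / Real.exp y = (ℓ * p) ^ α := by
    rw [hz, Real.exp_add, mul_div_cancel_left₀ _ (Real.exp_pos y).ne', mul_comm α, Real.exp_mul,
      Real.exp_log hx]
  rw [h2, idPow, one_div, Real.rpow_rpow_inv hx.le hα.ne'] at h1
  have h3 := hω.dominatesLog.le_logWeight hℓ p.cast_nonneg z
  have h4 := mul_le_mul_of_nonneg_left (log_factorial_le p) hα.le
  have h5 := div_le_div_of_nonneg_right h1 hℓ.le
  rw [sub_div, mul_div_cancel_left₀ _ hℓ.ne'] at h5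
  rw [hz, Real.log_mul hℓ.ne' hp'.ne'] at h3
  rw [hz, Real.log_mul hℓ.ne' hp'.ne', ← one_div] at h5
  linarith

/-- Supporting lines of the convex sequence of partial sums of a monotone sequence. -/
theorem sum_range_add_le {δ : ℕ → ℝ} (hδ : Monotone δ) (p q : ℕ) :
    ∑ j ∈ Finset.range p, δ j + ((q : ℝ) - p) * δ p ≤ ∑ j ∈ Finset.range q, δ j := by
  rcases le_total p q with h | h
  · have h1 := Finset.card_nsmul_le_sum (Finset.Ico p q) δ (δ p)
      fun j hj => hδ (Finset.mem_Ico.1 hj).1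
    rw [Nat.card_Ico, nsmul_eq_mul, Nat.cast_sub h, Finset.sum_Ico_eq_sub _ h] at h1
    linarith
  · have h1 := Finset.sum_le_card_nsmul (Finset.Ico q p) δ (δ p)
      fun j hj => hδ (Finset.mem_Ico.1 hj).2.le
    rw [Nat.card_Ico, nsmul_eq_mul, Nat.cast_sub h, Finset.sum_Ico_eq_sub _ h] at h1
    linarith

/-- If the quotients of `M` are equivalent to a non-decreasing sequence then `M` is equivalent to
a log-convex sequence. -/
theorem exists_monotone_log_approx {ω : ℝ → ℝ} {α γ ℓ : ℝ} (hω : IsBMTWeight ω) (hℓ : 0 < ℓ)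
    (hγ : α ≤ γ) (hT : ThilliezProperty (assocMatrix ω ℓ) γ) :
    ∃ (δ : ℕ → ℝ) (A : ℝ), Monotone δ ∧
      ∀ p : ℕ, |Real.log (quotientMatrix ω α ℓ p) - ∑ j ∈ Finset.range p, δ j| ≤ p * A := by
  obtain ⟨ν, a, ha, hν, hmono⟩ := hT
  have ha0 : 0 < a := by linarith
  have hM := assocMatrix_pos ω ℓ
  have hνpos : ∀ p : ℕ, 1 ≤ p → 0 < ν p := fun p hp =>
    (mul_pos (inv_pos.2 ha0) (quot_pos hM p)).trans_le (hν p hp).1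
  -- `δ j` is the logarithm of `ν_{j+1} / (j+1)^α`, shifted by one so that the sum over `j < p`
  -- approximates the logarithm of the `p`-th entry. It is monotone because `α ≤ γ`.
  refine ⟨fun j => Real.log (ν (j + 1)) - α * Real.log ((j + 1 : ℕ) : ℝ), Real.log a,
    monotone_nat_of_le_succ fun j => ?_, fun p => ?_⟩
  · have hj : (0 : ℝ) < ((j + 1 : ℕ) : ℝ) := by positivity
    have hj' : (0 : ℝ) < ((j + 1 + 1 : ℕ) : ℝ) := by positivity
    have h1 := hmono (j + 1) (by omega)
    have h2 := Real.log_le_log (div_pos (hνpos _ (by omega)) (Real.rpow_pos_of_pos hj γ)) h1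
    rw [Real.log_div (hνpos _ (by omega)).ne' (Real.rpow_pos_of_pos hj γ).ne',
      Real.log_div (hνpos _ (by omega)).ne' (Real.rpow_pos_of_pos hj' γ).ne',
      Real.log_rpow hj, Real.log_rpow hj'] at h2
    have h3 : Real.log ((j + 1 : ℕ) : ℝ) ≤ Real.log ((j + 1 + 1 : ℕ) : ℝ) :=
      Real.log_le_log hj (by exact_mod_cast (j + 1).le_succ)
    have h4 := mul_le_mul_of_nonneg_left h3 (sub_nonneg.2 hγ)
    linarith
  · induction p with
    | zero => simp [hω.quotientMatrix_zero α hℓ]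
    | succ p ih =>
      have hq := quot_pos hM (p + 1)
      have hb := hν (p + 1) (by omega)
      have h1 := Real.log_le_log (mul_pos (inv_pos.2 ha0) hq) hb.1
      have h2 := Real.log_le_log (hνpos (p + 1) (by omega)) hb.2
      rw [Real.log_mul (inv_pos.2 ha0).ne' hq.ne', Real.log_inv, log_quot_succ hM] at h1
      rw [Real.log_mul ha0.ne' hq.ne', log_quot_succ hM] at h2
      simp only [log_assocMatrix] at h1 h2
      have h3 : Real.log (p + 1).factorial =
          Real.log ((p + 1 : ℕ) : ℝ) + Real.log p.factorial := by
        rw [Nat.factorial_succ, Nat.cast_mul, Real.log_mul (by positivity)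
          (by exact_mod_cast p.factorial_ne_zero)]
      rw [log_quotientMatrix] at ih ⊢
      rw [Finset.sum_range_succ, h3, abs_le]
      rw [abs_le] at ih
      push_cast at ih h1 h2 ⊢
      constructor <;> linarith [ih.1, ih.2]

/-- A log-convex sequence is recovered by testing the conjugate at the slope `δ p` of its supporting
line. The shift by `-A` offsets the error for all `q` at once; it costs `p A`, as does the error at
`p`. -/
theorem log_quotientMatrix_le_logWeight (hω : IsBMTWeight ω) {γ ℓ : ℝ} (hℓ : 0 < ℓ)
    (hγ : α ≤ γ) (hT : ThilliezProperty (assocMatrix ω ℓ) γ)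
    (hv : DominatesLog (assocFun (quotientMatrix ω α ℓ))) : ∃ H : ℝ, ∀ p : ℕ,
      Real.log (quotientMatrix ω α ℓ p) ≤
        p * H + logWeight (assocFun (quotientMatrix ω α ℓ)) 1 p := by
  obtain ⟨δ, A, hδ, hA⟩ := exists_monotone_log_approx hω hℓ hγ hT
  refine ⟨2 * A, fun p => ?_⟩
  have h1 := hv.le_logWeight one_pos p.cast_nonneg (δ p - A)
  have h2 : assocFun (quotientMatrix ω α ℓ) (Real.exp (δ p - A)) ≤
      p * δ p - ∑ j ∈ Finset.range p, δ j := by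
    refine assocFun_le (quotientMatrix_pos ω α ℓ) fun q => ?_
    have h3 := sum_range_add_le hδ p q
    have h4 := (abs_le.1 (hA q)).1
    linarith
  have h5 := (abs_le.1 (hA p)).2
  rw [div_one] at h1
  linarith

/-- With `θ = ℓ/ℓ₀`, `q = ⌈θj⌉` and `r = j/q`, homogeneity relates exponent `j` to exponent `q`: the
index becomes `rℓ ≤ ℓ₀` for `ω`, while `q ≤ 2θj` gives index at least `ℓ'` for `v`. The factorials
satisfy `r log q! ≤ log j! + O(j)`. -/
theorem exists_log_quotientMatrix_le (hω : IsBMTWeight ω) (hα : 0 < α) {v : ℝ → ℝ}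
    (hv : DominatesLog v) {ℓ₀ ℓ' D H : ℝ} (hℓ₀ : 0 < ℓ₀) (hℓ' : 0 < ℓ')
    (hle : ∀ p : ℕ, Real.log (quotientMatrix ω α ℓ₀ p) ≤ D + p * H + logWeight v ℓ' p)
    {ℓ : ℝ} (hℓ : 0 < ℓ) : ∃ D' H' : ℝ, ∀ p : ℕ, Real.log (quotientMatrix ω α ℓ p) ≤
      D' + p * H' + logWeight v (2 * (ℓ / ℓ₀) * ℓ') p := by
  set θ := ℓ / ℓ₀ with hθ_def
  have hθ : 0 < θ := div_pos hℓ hℓ₀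
  set K := 2 * θ * ℓ' with hK_def
  have hK : 0 < K := by positivity
  set w₁ := logWeight ω ℓ₀ 1 with hw₁_def
  have hw₁ : 0 ≤ w₁ := hω.logWeight_nonneg hℓ₀ zero_le_one
  set E := |D| + |H| + α * (1 + |Real.log (2 * θ)|) with hE_def
  have hE : 0 ≤ E := by positivity
  have hv1 : 0 ≤ v 1 / K := div_nonneg (hv.nonneg 1 zero_le_one) hK.le
  -- The first constant serves the finitely many `j` with `θj < 1`, where `q ≤ 2θj` may fail; `E`
  -- collects the geometric errors for the other `j`.
  refine ⟨w₁ / θ + v 1 / K, E + 2 * θ * |H|, fun j => ?_⟩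
  have hfac : 0 ≤ Real.log (j.factorial : ℝ) :=
    Real.log_nonneg (by exact_mod_cast j.factorial_pos)
  have hj0 : (0 : ℝ) ≤ j := j.cast_nonneg
  rw [log_quotientMatrix]
  rcases lt_or_ge (θ * j) 1 with hj | hj
  · have h1 : logWeight ω ℓ j ≤ j * w₁ := by
      rcases j.eq_zero_or_pos with rfl | hjp
      · simp [hω.logWeight_zero hℓ]
      · have hjp' : (0 : ℝ) < j := by exact_mod_cast hjp
        have := logWeight_mul ω (ℓ := ℓ) hjp' 1
        rw [mul_one] at this
        rw [this]
        refine mul_le_mul_of_nonneg_left ?_ hj0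
        refine hω.dominatesLog.logWeight_mono (mul_pos hjp' hℓ) ?_ zero_le_one
        have := mul_le_mul_of_nonneg_right hj.le hℓ₀.le
        rw [hθ_def, div_mul_eq_mul_div, div_mul_cancel₀ _ hℓ₀.ne', one_mul] at this
        linarith
    have h2 : (j : ℝ) * w₁ ≤ w₁ / θ := by
      rw [le_div_iff₀ hθ]
      nlinarith
    have h3 := hv.le_logWeight hK hj0 0
    rw [mul_zero, Real.exp_zero] at h3
    have h4 := mul_nonneg hα.le hfac
    have h5 : 0 ≤ j * (E + 2 * θ * |H|) := by positivity
    linarith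
  · have hjp : (0 : ℝ) < j := by
      by_contra! h
      nlinarith
    set q := ⌈θ * j⌉₊ with hq_def
    have hq1 : θ * j ≤ q := Nat.le_ceil _
    have hq2 : (q : ℝ) < θ * j + 1 := Nat.ceil_lt_add_one (by positivity)
    have hqj : (q : ℝ) ≤ 2 * θ * j := by linarith
    have hq1' : (1 : ℝ) ≤ q := hj.trans hq1
    have hq0 : (0 : ℝ) < q := by linarith
    set r : ℝ := j / q with hr_def
    have hr : 0 < r := div_pos hjp hq0
    have hrq : r * q = j := div_mul_cancel₀ _ hq0.ne'
    have hrj : r ≤ j := div_le_self hj0 hq1'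
    have h1 : logWeight ω ℓ j ≤ r * logWeight ω ℓ₀ q := by
      rw [← hrq, logWeight_mul ω hr]
      refine mul_le_mul_of_nonneg_left ?_ hr.le
      refine hω.dominatesLog.logWeight_mono (mul_pos hr hℓ) ?_ hq0.le
      rw [hr_def, div_mul_eq_mul_div, div_le_iff₀ hq0]
      have := mul_le_mul_of_nonneg_right hq1 hℓ₀.le
      rw [hθ_def, div_mul_eq_mul_div, div_mul_cancel₀ _ hℓ₀.ne'] at this
      linarith
    have h2 : r * logWeight v ℓ' q ≤ logWeight v K j := by
      rw [← hrq, logWeight_mul v hr]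
      refine mul_le_mul_of_nonneg_left ?_ hr.le
      refine hv.logWeight_mono hℓ' ?_ hq0.le
      have : q * ℓ' ≤ 2 * θ * j * ℓ' := mul_le_mul_of_nonneg_right hqj hℓ'.le
      rw [hK_def, hr_def, div_mul_eq_mul_div, le_div_iff₀ hq0]
      linarith
    have h3 := hle q
    rw [log_quotientMatrix] at h3
    have h4 := mul_le_mul_of_nonneg_left h3 hr.le
    have h5 : r * Real.log q.factorial ≤ Real.log j.factorial + j * (1 + |Real.log (2 * θ)|) := by
      have e1 := mul_le_mul_of_nonneg_left (log_factorial_le q) hr.le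
      rw [← mul_assoc, hrq] at e1
      have e2 : Real.log q ≤ Real.log (2 * θ) + Real.log j := by
        rw [← Real.log_mul (by positivity) hjp.ne']
        exact Real.log_le_log hq0 hqj
      have e3 := mul_le_mul_of_nonneg_left e2 hj0
      have e4 := mul_log_le_log_factorial_add j
      have e5 := mul_le_mul_of_nonneg_left (le_abs_self (Real.log (2 * θ))) hj0
      linarith
    have h6 := mul_le_mul_of_nonneg_left h5 hα.le
    have h7 : r * D ≤ j * |D| :=
      (mul_le_mul_of_nonneg_left (le_abs_self D) hr.le).trans
        (mul_le_mul_of_nonneg_right hrj (abs_nonneg D))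
    have h8 : r * (q * H) ≤ j * |H| := by
      rw [← mul_assoc, hrq]
      exact mul_le_mul_of_nonneg_left (le_abs_self H) hj0
    have h9 : 0 ≤ w₁ / θ := by positivity
    have h10 : 0 ≤ j * (2 * θ * |H|) := by positivity
    have h11 : (j : ℝ) * E = j * |D| + j * |H| + α * (j * (1 + |Real.log (2 * θ)|)) := by
      rw [hE_def]
      ring
    linarith

theorem matrixScale_quotientMatrix_pos (ω : ℝ → ℝ) (α : ℝ) :
    ∀ w ∈ matrixScale (quotientMatrix ω α), ∀ n, 0 < w n := by
  rintro _ ⟨h, ℓ, hh, _, rfl⟩ n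
  exact mul_pos (pow_pos hh n) (quotientMatrix_pos ω α ℓ n)

theorem exp_mul_exp_log {h M : ℝ} (hh : 0 < h) (hM : 0 < M) (n : ℕ) :
    h ^ n * M = Real.exp (n * Real.log h + Real.log M) := by
  rw [Real.exp_add, Real.exp_log hM, ← Real.log_pow, Real.exp_log (pow_pos hh n)]

/-- Where the matrix weight may be chosen, `h` cancels `e^{Hp}`; where `h` is given, stability under
dilation moves it into the index of `v`. -/
theorem scaleEquiv_quotientMatrix {v : ℝ → ℝ} (hv : DominatesLog v) (hstab : StableUnderDilation v)
    {κ : ℝ} (hκ : 0 < κ)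
    (hle : ∀ ℓ, 0 < ℓ → ∃ D H : ℝ, ∀ p : ℕ,
      Real.log (quotientMatrix ω α ℓ p) ≤ D + p * H + logWeight v (κ * ℓ) p)
    (hge : ∀ ℓ, 0 < ℓ → ∃ H : ℝ, ∀ p : ℕ,
      logWeight v ℓ p ≤ Real.log (quotientMatrix ω α ℓ p) + p * H) :
    ScaleEquiv (matrixScale (quotientMatrix ω α)) (functionScale v) := by
  have hQ := quotientMatrix_pos ω α
  refine ⟨matrixScale_quotientMatrix_pos ω α, functionScale_pos v, ?_, ?_, ?_, ?_⟩
  · rintro _ ⟨h, ℓ, hh, hℓ, rfl⟩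
    obtain ⟨D, H, hDH⟩ := hle ℓ hℓ
    obtain ⟨A, hA, hA'⟩ := hstab.exists_logWeight_le hv (Real.log h + H)
    obtain ⟨D', hD'⟩ := hA' (κ * ℓ) (by positivity)
    refine ⟨_, ⟨A * (κ * ℓ), by positivity, rfl⟩, Real.exp (D + D'), fun n => ?_⟩
    simp only
    rw [exp_mul_exp_log hh (hQ ℓ n), assocMatrix_eq_exp, ← Real.exp_add, Real.exp_le_exp]
    have h1 := hD' n n.cast_nonneg
    linarith [hDH n]
  · rintro _ ⟨ℓ, hℓ, rfl⟩
    obtain ⟨H, hH⟩ := hge ℓ hℓ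
    refine ⟨_, ⟨Real.exp H, ℓ, Real.exp_pos H, hℓ, rfl⟩, 1, fun n => ?_⟩
    rw [exp_mul_exp_log (Real.exp_pos H) (hQ ℓ n), assocMatrix_eq_exp, one_mul, Real.exp_le_exp,
      Real.log_exp]
    linarith [hH n]
  · rintro _ ⟨ℓ, hℓ, rfl⟩
    obtain ⟨D, H, hDH⟩ := hle (ℓ / κ) (by positivity)
    refine ⟨_, ⟨Real.exp (-H), ℓ / κ, Real.exp_pos _, by positivity, rfl⟩, Real.exp D,
      fun n => ?_⟩
    rw [exp_mul_exp_log (Real.exp_pos _) (hQ _ n), assocMatrix_eq_exp, ← Real.exp_add,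
      Real.exp_le_exp, Real.log_exp]
    have h1 := hDH n
    rw [mul_div_cancel₀ _ hκ.ne'] at h1
    linarith
  · rintro _ ⟨h, ℓ, hh, hℓ, rfl⟩
    obtain ⟨H, hH⟩ := hge ℓ hℓ
    obtain ⟨A, hA, hA'⟩ := hstab.exists_logWeight_le hv (H - Real.log h)
    obtain ⟨D, hD⟩ := hA' (ℓ / A) (by positivity)
    refine ⟨_, ⟨ℓ / A, by positivity, rfl⟩, Real.exp D, fun n => ?_⟩
    simp only
    rw [exp_mul_exp_log hh (hQ ℓ n), assocMatrix_eq_exp, ← Real.exp_add, Real.exp_le_exp]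
    have h1 := hD n n.cast_nonneg
    rw [mul_div_cancel₀ _ hA.ne'] at h1
    linarith [hH n]

end MatrixScale

/-! ### Weight function properties and the main theorem -/

theorem isWeightFunction_of_leUpToConst {v₀ v : ℝ → ℝ} (hv₀ : DominatesLog v₀)
    (h : LeUpToConst v₀ v) (hnn : ∀ t, 0 ≤ t → 0 ≤ v t) (hmono : MonotoneOn v (Ici 0)) :
    IsWeightFunction v ∧ Real.log =o[atTop] v :=
  have hv := hv₀.of_leUpToConst h hnn
  ⟨⟨hnn, hmono, hv.tendsto⟩, hv.log_isLittleO⟩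

theorem LeUpToConst.of_le {σ τ : ℝ → ℝ} {D : ℝ} (h : ∀ t, 0 < t → σ t ≤ τ t + D) :
    LeUpToConst σ τ := ⟨1, D, one_pos, fun t ht => by rw [one_mul]; exact h t ht⟩

end WeightedSpaces

end

theorem theorem5p15 (ω : ℝ → ℝ) (hω : IsBMTWeight ω) (α : ℝ) (hα : 0 < α)
    (ℓ₀ : ℝ) (hℓ₀ : 0 < ℓ₀)
    (hindex : ENNReal.ofReal α < thilliezIndex (assocMatrix ω ℓ₀))
    (hgrowth : ω =o[atTop] fun t : ℝ => t ^ (1 / α)) :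
    -- all suprema that define the weights are finite
    (AssocFunFinite (gevrey α) ∧
      (∀ ℓ : ℝ, 0 < ℓ → AssocFunFinite (assocMatrix ω ℓ)) ∧
      (∀ c : ℝ, 0 < c → AssocFunFinite (quotientMatrix ω α (c * ℓ₀))) ∧
      (∀ ℓ : ℝ, 0 < ℓ →
        UpperConjFinite (assocFun (assocMatrix ω ℓ)) (assocFun (gevrey α))) ∧
      UpperConjFinite ω (assocFun (gevrey α)) ∧
      UpperConjFinite ω (idPow (1 / α)) ∧
      UpperLegendreFinite (powSubst ω α)) ∧
    -- the five functions are weight functions that dominate the logarithm, so that the spaces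
    -- defined by them make sense
    (∀ c ℓ : ℝ, 0 < c → 0 < ℓ →
      ∀ v ∈ ({assocFun (quotientMatrix ω α (c * ℓ₀)),
          upperConj (assocFun (assocMatrix ω ℓ)) (assocFun (gevrey α)),
          upperConj ω (assocFun (gevrey α)),
          upperConj ω (idPow (1 / α)),
          powSubst (inversion (upperLegendre (powSubst ω α))) (1 / α)} : Set (ℝ → ℝ)),
        IsWeightFunction v ∧ Real.log =o[atTop] v) ∧
    -- the equalities of locally convex vector spaces
    ∀ (𝔉 : SpaceSymbol) (κ : Kind) (c ℓ : ℝ), 0 < c → 0 < ℓ →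
      𝔉.matrixSpace κ (quotientMatrix ω α) =
          𝔉.functionSpace κ (assocFun (quotientMatrix ω α (c * ℓ₀))) ∧
      𝔉.functionSpace κ (assocFun (quotientMatrix ω α (c * ℓ₀))) =
          𝔉.functionSpace κ
            (upperConj (assocFun (assocMatrix ω ℓ)) (assocFun (gevrey α))) ∧
      𝔉.functionSpace κ (upperConj (assocFun (assocMatrix ω ℓ)) (assocFun (gevrey α))) =
          𝔉.functionSpace κ (upperConj ω (assocFun (gevrey α))) ∧
      𝔉.functionSpace κ (upperConj ω (assocFun (gevrey α))) =
          𝔉.functionSpace κ (upperConj ω (idPow (1 / α))) ∧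
      𝔉.functionSpace κ (upperConj ω (idPow (1 / α))) =
          𝔉.functionSpace κ
            (powSubst (inversion (upperLegendre (powSubst ω α))) (1 / α)) := by
  have hω0 : ω 0 = 0 := hω.normalized 0 le_rfl zero_le_one
  obtain ⟨γ, hαγ, -, hT⟩ := exists_thilliezProperty hindex
  have hfin := hω.upperConjFinite_idPow hgrowth
  have hstab := hω.stableUnderDilation hα hfin (hω.slowDilation hα hαγ hℓ₀ hT)
  set v := upperConj ω (idPow (1 / α)) with hv_def
  have hG := assocFunFinite_gevrey hα
  have hG0 := assocFun_zero (gevrey_zero α)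
  have hGmono := hG.monotoneOn (gevrey_pos α) (gevrey_zero α)
  have hGle : ∀ s, 0 ≤ s → assocFun (gevrey α) s ≤ α * s ^ (1 / α) :=
    fun s hs => assocFun_gevrey_le hα hs
  have hGge : ∀ s, 0 ≤ s → α / 2 * s ^ (1 / α) ≤ assocFun (gevrey α) s + α * Real.log 2 :=
    fun s hs => le_assocFun_gevrey hα hs
  have hα2 : 0 < α / 2 := by positivity
  -- the conjugate of `ω` with `ω_{G^α}`
  have hωle : ∀ s, 0 ≤ s → ω s ≤ 1 * ω s + 0 := fun s _ => by simp
  have hfin₃ : UpperConjFinite ω (assocFun (gevrey α)) :=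
    (hfin.of_power hα one_pos hα2 hωle hGge).1
  have h₃v := hfin.leUpToConst_power hα hstab one_pos hα2 hωle hGge
  have hv₃ := hfin₃.power_leUpToConst hα hstab one_pos hα hωle hGle
  -- the conjugates of `ω_{W^(ℓ)}` with `ω_{G^α}`
  have hfin₂ : ∀ ℓ : ℝ, 0 < ℓ →
      UpperConjFinite (assocFun (assocMatrix ω ℓ)) (assocFun (gevrey α)) :=
    fun ℓ hℓ => upperConjFinite_assocFun hω hα hfin hℓ
  have h₂v : ∀ ℓ : ℝ, 0 < ℓ →
      LeUpToConst (upperConj (assocFun (assocMatrix ω ℓ)) (assocFun (gevrey α))) v :=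
    fun ℓ hℓ => hfin.leUpToConst_power hα hstab (one_div_pos.2 hℓ) hα2 (D := 0)
      (fun s hs => by rw [one_div_mul_eq_div, add_zero]; exact hω.assocFun_le hℓ hs) hGge
  have hv₂ : ∀ ℓ : ℝ, 0 < ℓ →
      LeUpToConst v (upperConj (assocFun (assocMatrix ω ℓ)) (assocFun (gevrey α))) :=
    fun ℓ hℓ => (hfin₂ ℓ hℓ).power_leUpToConst hα hstab (mul_pos two_pos hℓ) hα
      (fun s hs => hω.le_assocFun hℓ hs) hGle
  -- the functions associated with `W^(ℓ) / G^α`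
  have hfin₁ : ∀ ℓ : ℝ, 0 < ℓ → AssocFunFinite (quotientMatrix ω α ℓ) :=
    fun ℓ hℓ => assocFunFinite_quotientMatrix hω hα hfin hℓ
  have hv₁ : ∀ ℓ : ℝ, 0 < ℓ → LeUpToConst v (assocFun (quotientMatrix ω α ℓ)) :=
    fun ℓ hℓ => (hv₂ ℓ hℓ).trans (.of_le (D := 0) fun t ht => by
      rw [add_zero]; exact upperConj_le_assocFun_quotientMatrix hω hα hfin hℓ ht)
  have h₁v : ∀ ℓ : ℝ, 0 < ℓ → LeUpToConst (assocFun (quotientMatrix ω α ℓ)) v := fun ℓ hℓ => by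
    obtain ⟨C, D, hC, h⟩ := h₂v ℓ hℓ
    -- The dilation by `e^α` is removed by stability of `v`.
    exact LeUpToConst.trans ⟨C, D, hC, fun t ht =>
      (assocFun_quotientMatrix_le hω hα hfin hℓ ht).trans (h _ (mul_pos (Real.exp_pos α) ht))⟩
      (hstab _ (Real.exp_pos α))
  -- all functions dominate the logarithm
  have hid0 : idPow (1 / α) 0 = 0 := idPow_zero (by positivity)
  have hωv : LeUpToConst ω v := .of_le (D := 1) fun t ht => by linarith [hfin.sub_one_le ht]
  have hv : DominatesLog v := hω.dominatesLog.of_leUpToConst hωv fun t ht => hfin.nonneg hω0 hid0 ht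
  have nn₁ : ∀ ℓ : ℝ, 0 < ℓ → ∀ t, 0 ≤ t → 0 ≤ assocFun (quotientMatrix ω α ℓ) t :=
    fun ℓ hℓ t ht => (hfin₁ ℓ hℓ).nonneg (hω.quotientMatrix_zero α hℓ) ht
  have nn₂ : ∀ ℓ : ℝ, 0 < ℓ → ∀ t, 0 ≤ t →
      0 ≤ upperConj (assocFun (assocMatrix ω ℓ)) (assocFun (gevrey α)) t :=
    fun ℓ hℓ t ht => (hfin₂ ℓ hℓ).nonneg (assocFun_zero (hω.assocMatrix_zero hℓ)) hG0 ht
  have nn₃ : ∀ t, 0 ≤ t → 0 ≤ upperConj ω (assocFun (gevrey α)) t :=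
    fun t ht => hfin₃.nonneg hω0 hG0 ht
  have dl₁ : ∀ ℓ : ℝ, 0 < ℓ → DominatesLog (assocFun (quotientMatrix ω α ℓ)) :=
    fun ℓ hℓ => hv.of_leUpToConst (hv₁ ℓ hℓ) (nn₁ ℓ hℓ)
  have dl₂ : ∀ ℓ : ℝ, 0 < ℓ →
      DominatesLog (upperConj (assocFun (assocMatrix ω ℓ)) (assocFun (gevrey α))) :=
    fun ℓ hℓ => hv.of_leUpToConst (hv₂ ℓ hℓ) (nn₂ ℓ hℓ)
  have dl₃ : DominatesLog (upperConj ω (assocFun (gevrey α))) := hv.of_leUpToConst hv₃ nn₃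
  have heq : ∀ t, 0 ≤ t →
      powSubst (inversion (upperLegendre (powSubst ω α))) (1 / α) t = v t :=
    fun t ht => powSubst_inversion_upperLegendre hω0 hα ht
  have hvmono : MonotoneOn v (Ici 0) := hω.monotoneOn_upperConj_idPow hα hfin
  refine ⟨⟨hG, fun ℓ hℓ => hω.assocFunFinite hℓ, fun c hc => hfin₁ _ (mul_pos hc hℓ₀), hfin₂,
    hfin₃, hfin, hfin.upperLegendreFinite hα⟩, ?_, ?_⟩
  · intro c ℓ hc hℓ u hu
    simp only [mem_insert_iff, mem_singleton_iff] at hu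
    have hcℓ := mul_pos hc hℓ₀
    rcases hu with rfl | rfl | rfl | rfl | rfl
    · exact isWeightFunction_of_leUpToConst hv (hv₁ _ hcℓ) (nn₁ _ hcℓ)
        ((hfin₁ _ hcℓ).monotoneOn (quotientMatrix_pos ω α _) (hω.quotientMatrix_zero α hcℓ))
    · exact isWeightFunction_of_leUpToConst hv (hv₂ ℓ hℓ) (nn₂ ℓ hℓ)
        ((hfin₂ ℓ hℓ).monotoneOn (assocFun_zero (hω.assocMatrix_zero hℓ)) hG0 hGmono)
    · exact isWeightFunction_of_leUpToConst hv hv₃ nn₃ (hfin₃.monotoneOn hω0 hG0 hGmono)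
    · exact ⟨⟨hv.nonneg, hvmono, hv.tendsto⟩, hv.log_isLittleO⟩
    · exact isWeightFunction_of_leUpToConst hv
        (.of_le (D := 0) fun t ht => by rw [add_zero, heq t ht.le])
        (fun t ht => by rw [heq t ht]; exact hv.nonneg t ht)
        (hvmono.congr fun t ht => (heq t ht).symm)
  · intro 𝔉 κ c ℓ hc hℓ
    have hcℓ := mul_pos hc hℓ₀
    have hscale : ScaleEquiv (matrixScale (quotientMatrix ω α)) (functionScale v) := by
      -- Log-convexity is available at `ℓ₀` only. There index `1` for `ω_{W^(ℓ₀)/G^α}` becomes index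
      -- `C` for `v`, and the transfer to `k` yields `2 (k/ℓ₀) C`, hence the value of `κ`.
      obtain ⟨H, hH⟩ := log_quotientMatrix_le_logWeight hω hℓ₀ hαγ.le hT (dl₁ ℓ₀ hℓ₀)
      obtain ⟨C, D, hC, hCD⟩ := hv₁ ℓ₀ hℓ₀
      refine scaleEquiv_quotientMatrix hv hstab (κ := 2 * C / ℓ₀) (by positivity)
        (fun k hk => ?_) fun k hk => ⟨_, logWeight_upperConj_le hω hα hfin hk⟩
      have hκ : 2 * C / ℓ₀ * k = 2 * (k / ℓ₀) * C := by ring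
      rw [hκ]
      refine exists_log_quotientMatrix_le hω hα hv (D := D / C) (H := H) hℓ₀ hC (fun p => ?_) hk
      have h1 := hv.logWeight_le_of_le (τ := assocFun (quotientMatrix ω α ℓ₀)) hC one_pos
        (fun t ht => by rw [div_one]; exact hCD t ht) one_pos p.cast_nonneg
      rw [Real.log_one, mul_zero, zero_add, mul_one] at h1
      linarith [hH p]
    have e₁ := ScaleEquiv.of_leUpToConst (dl₁ _ hcℓ) hv (h₁v _ hcℓ) (hv₁ _ hcℓ)
    have e₂ := ScaleEquiv.of_leUpToConst (dl₂ ℓ hℓ) hv (h₂v ℓ hℓ) (hv₂ ℓ hℓ)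
    have e₃ := ScaleEquiv.of_leUpToConst dl₃ hv h₃v hv₃
    refine ⟨𝔉.space_congr κ (hscale.trans e₁.symm), 𝔉.space_congr κ (e₁.trans e₂.symm),
      𝔉.space_congr κ (e₂.trans e₃.symm), 𝔉.space_congr κ e₃, ?_⟩
    -- The last two functions agree on `[0, +∞)`, so their scales are literally equal.
    exact congrArg (𝔉.space κ) (functionScale_congr fun t ht => (heq t ht.le).symm)
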